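/- **Setting.** There are $N\ge 1$ arms and $T$ rounds. An oblivious adversary fixes loss vectors $\ell_1,\dots,\ell_T\in[0,1]^N$. Given a concave differentiable potential $\tilde\Phi:\mathbb R^N\to\mathbb R$ with $\nabla\tilde\Phi\in\Delta_N$ (the probability simplex), the bandit Gradient Based Prediction Algorithm (GBPA) starts with $\hat L_0=0$. In round $t$ it draws $i_t$ from $p_t=\nabla\tilde\Phi(\hat L_{t-1})$, observes only $\ell_{t,i_t}$, forms the estimate $\hat\ell_t=\frac{\ell_{t,i_t}}{p_{t,i_t}}\mathbf e_{i_t}$ and sets $\hat L_t=\hat L_{t-1}+\hat\ell_t$. Its expected regret is $\mathbb E\big[\sum_{t=1}^T\ell_{t,i_t}\big]-L_T^*$, where $L_T^*=\min_i\sum_{t=1}^T\ell_{t,i}$. FTPL with law $\mathcal D$ uses $\tilde\Phi(L)=\mathbb E[\min_i(L_i-Z_i)]$ with $Z_1,\dots,Z_N$ i.i.d. from $\mathcal D$; FTRL with regularizer $F$ uses $\tilde\Phi(L)=\min_{p\in\Delta_N}(\langle p,L\rangle+F(p))$. Write $\log_\alpha(x)=\frac{x^{1-\alpha}-1}{1-\alpha}$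 for $\alpha\ne1$. **Theorem.** In each of the following cases the potential is admissible (well defined, concave, differentiable, with gradient in $\Delta_N$), and the bandit GBPA satisfies the stated bound. 1. There is a universal constant $C$ such that for each of the families Gamma (shape, rate), Gumbel (location, scale), Fréchet (shape $>1$, scale), Weibull (scale, shape) and Pareto (scale, shape), and all $N,T$, there is a choice of the distribution parameters (depending on $N,T$ only) for which FTPL has expected regret at most $C\sqrt{NT\log N}$ on every loss sequence. 2. For every $\alpha\in(0,1)$ there is a constant $C$ depending only on $\alpha$ such that for all $N,T$ there is $\eta>0$ (depending on $\alpha,N,T$ only) for which FTRL with the Tsallis neg-entropy $F(p)=-\eta\sum_{i=1}^N p_i\log_\alpha(1/p_i)$ has expected regret at most $C\sqrt{NT}$ on every loss sequence. 3. There is a universal constant $C$ such that for all $N,T$ and every value of $L_T^*$ there is $\eta>0$ (depending on $N$, $T$ and the value $L_T^*$ only) for which FTRL with the log-barrier $F(p)=-\eta\sum_{i=1}^N\log p_i$ has expected regret at most $C\big(\sqrt{N L_T^*\log(NT)}+N\log(NT)\big)$ on every loss sequence with that value of $L_T^*$. (For $T=0$, $\log(NT)$ is read as $0$.) -/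

import Mathlib

open MeasureTheory ProbabilityTheory

noncomputable section

namespace Bandit

/-! ### The gradient based prediction algorithm with bandit feedback -/

/-- The `i`-th coordinate `∇ᵢ Φ (L)` of the gradient of a potential `Φ : ℝᴺ → ℝ` at `L`. -/
def grad {N : ℕ} (Φ : (Fin N → ℝ) → ℝ) (L : Fin N → ℝ) (i : Fin N) : ℝ :=
  fderiv ℝ Φ L (Pi.single i 1)

/-- The admissible inputs of the algorithm: concave (differentiable) potentials on `ℝᴺ` all of whose
gradients are probability vectors. -/
structure IsPotential {N : ℕ} (Φ : (Fin N → ℝ) → ℝ) : Prop where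
  concave : ConcaveOn ℝ Set.univ Φ
  differentiable : Differentiable ℝ Φ
  grad_mem : ∀ L, grad Φ L ∈ stdSimplex ℝ (Fin N)

/-- The cumulative loss estimate after `t` rounds, when the losses are `ℓ` and the actions drawn are
`a`. It starts at `0`; in the round with (zero-based) index `t` the vector that has the entry
`ℓ t (a t) / p (a t)` in position `a t` and zeros elsewhere is added, where `p` is the gradient of `Φ`
at the current estimate. After the last round it no longer changes. -/
def cumEst {N T : ℕ} (Φ : (Fin N → ℝ) → ℝ) (ℓ : Fin T → Fin N → ℝ) (a : Fin T → Fin N) :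
    ℕ → (Fin N → ℝ)
  | 0 => 0
  | t + 1 =>
    if h : t < T then
      cumEst Φ ℓ a t +
        Pi.single (a ⟨t, h⟩) (ℓ ⟨t, h⟩ (a ⟨t, h⟩) / grad Φ (cumEst Φ ℓ a t) (a ⟨t, h⟩))
    else cumEst Φ ℓ a t

/-- The distribution from which the action of round `t` is drawn; it depends on `a` only through the
actions drawn before round `t`. -/
def playDist {N T : ℕ} (Φ : (Fin N → ℝ) → ℝ) (ℓ : Fin T → Fin N → ℝ) (a : Fin T → Fin N)
    (t : Fin T) : Fin N → ℝ :=
  grad Φ (cumEst Φ ℓ a t)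

/-- The probability that the algorithm draws the sequence of actions `a`. -/
def pathProb {N T : ℕ} (Φ : (Fin N → ℝ) → ℝ) (ℓ : Fin T → Fin N → ℝ) (a : Fin T → Fin N) : ℝ :=
  ∏ t, playDist Φ ℓ a t (a t)

/-- The expected total loss of the algorithm over `T` rounds. -/
def expectedLoss {N T : ℕ} (Φ : (Fin N → ℝ) → ℝ) (ℓ : Fin T → Fin N → ℝ) : ℝ :=
  ∑ a : Fin T → Fin N, pathProb Φ ℓ a * ∑ t, ℓ t (a t)

/-- The total loss of the best action in hindsight. -/
def bestLoss {N T : ℕ} (ℓ : Fin T → Fin N → ℝ) : ℝ :=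
  ⨅ i, ∑ t, ℓ t i

/-- The expected regret of the bandit algorithm with potential `Φ` on the loss sequence `ℓ`. -/
def expectedRegret {N T : ℕ} (Φ : (Fin N → ℝ) → ℝ) (ℓ : Fin T → Fin N → ℝ) : ℝ :=
  expectedLoss Φ ℓ - bestLoss ℓ

/-- All losses lie in `[0, 1]`. -/
def UnitLosses {N T : ℕ} (ℓ : Fin T → Fin N → ℝ) : Prop :=
  ∀ t i, ℓ t i ∈ Set.Icc (0 : ℝ) 1

/-! ### Follow the perturbed leader -/

/-- The potential `L ↦ 𝔼 [minᵢ (Lᵢ - Zᵢ)]`, where `Z₁, …, Z_N` are independent with law `D`. -/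
def ftplPotential (N : ℕ) (D : Measure ℝ) (L : Fin N → ℝ) : ℝ :=
  ∫ z, ⨅ i, (L i - z i) ∂(Measure.pi fun _ : Fin N => D)

/-- The Gumbel law with location `m` and scale `b`. -/
def gumbelMeasure (m b : ℝ) : Measure ℝ :=
  volume.withDensity fun x =>
    ENNReal.ofReal (1 / b * Real.exp (-((x - m) / b) - Real.exp (-((x - m) / b))))

/-- The Fréchet law with shape `α` and scale `s` (and location `0`). -/
def frechetMeasure (α s : ℝ) : Measure ℝ :=
  volume.withDensity fun x =>
    ENNReal.ofReal
      (if 0 < x then α / s * (x / s) ^ (-α - 1) * Real.exp (-(x / s) ^ (-α)) else 0)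

/-- The Weibull law with scale `s` and shape `k`. -/
def weibullMeasure (s k : ℝ) : Measure ℝ :=
  volume.withDensity fun x =>
    ENNReal.ofReal
      (if 0 < x then k / s * (x / s) ^ (k - 1) * Real.exp (-(x / s) ^ k) else 0)

/-- The five families of perturbations. -/
inductive Family
  | gamma
  | gumbel
  | frechet
  | weibull
  | pareto

/-- The laws that belong to a family, for all admissible values of the distribution parameters. -/
def Family.laws : Family → Set (Measure ℝ)
  | .gamma => {D | ∃ shape rate : ℝ, 0 < shape ∧ 0 < rate ∧ D = gammaMeasure shape rate}
  | .gumbel => {D | ∃ loc scale : ℝ, 0 < scale ∧ D = gumbelMeasure loc scale}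
  | .frechet => {D | ∃ shape scale : ℝ, 1 < shape ∧ 0 < scale ∧ D = frechetMeasure shape scale}
  | .weibull => {D | ∃ scale shape : ℝ, 0 < scale ∧ 0 < shape ∧ D = weibullMeasure scale shape}
  | .pareto => {D | ∃ scale shape : ℝ, 0 < scale ∧ 0 < shape ∧ D = paretoMeasure scale shape}

/-! ### Follow the regularized leader -/

/-- The objective `p ↦ ⟨p, L⟩ + F p`. -/
def ftrlObjective {N : ℕ} (F : (Fin N → ℝ) → ℝ) (L p : Fin N → ℝ) : ℝ :=
  ∑ i, p i * L i + F p

/-- The potential `L ↦ min (⟨p, L⟩ + F p)`, the minimum being over the probability vectors `p` in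
`S`, the set on which the regularizer is finite. -/
def ftrlPotential {N : ℕ} (S : Set (Fin N → ℝ)) (F : (Fin N → ℝ) → ℝ) (L : Fin N → ℝ) : ℝ :=
  sInf (ftrlObjective F L '' S)

/-- The minimum that defines the potential is attained, for every `L`. -/
def MinAttained {N : ℕ} (S : Set (Fin N → ℝ)) (F : (Fin N → ℝ) → ℝ) : Prop :=
  ∀ L, ∃ p ∈ S, IsMinOn (ftrlObjective F L) S p

/-- The Tsallis logarithm with parameter `α`. -/
def tsallisLog (α x : ℝ) : ℝ :=
  if α = 1 then Real.log x else (x ^ (1 - α) - 1) / (1 - α)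

/-- The Tsallis negative entropy `F p = -η ∑ᵢ pᵢ log_α (1 / pᵢ)`. For `0 < α < 1` it is finite and
continuous on the whole simplex (a summand with `pᵢ = 0` is `0`). -/
def tsallisNegEntropy {N : ℕ} (α η : ℝ) (p : Fin N → ℝ) : ℝ :=
  -η * ∑ i, p i * tsallisLog α (1 / p i)

/-- The log-barrier `F p = -η ∑ᵢ log pᵢ`, for `p` with positive coordinates. -/
def logBarrier {N : ℕ} (η : ℝ) (p : Fin N → ℝ) : ℝ :=
  -η * ∑ i, Real.log (p i)

/-- The probability vectors with positive coordinates. The log-barrier is finite on this set and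
`+∞` on the rest of the simplex. -/
def openSimplex (N : ℕ) : Set (Fin N → ℝ) :=
  {p ∈ stdSimplex ℝ (Fin N) | ∀ i, 0 < p i}

/-- The potential of FTRL with the Tsallis negative entropy. -/
def tsallisPotential (N : ℕ) (α η : ℝ) : (Fin N → ℝ) → ℝ :=
  ftrlPotential (stdSimplex ℝ (Fin N)) (tsallisNegEntropy α η)

/-- The potential of FTRL with the log-barrier. -/
def logBarrierPotential (N : ℕ) (η : ℝ) : (Fin N → ℝ) → ℝ :=
  ftrlPotential (openSimplex N) (logBarrier η)

end Bandit

end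

/-! Everything rests on one potential argument. Let p = ∇Φ(L). The importance-weighted estimates
never exceed the true losses in expectation. Hence, if u ≥ 0 and Φ(L) ≤ ⟨u, L⟩ + K for all L,
following Φ along the run shows that κ times the expected loss is at most the loss of u, plus K -
Φ(0), plus a cost c per round (`expectedLoss_le_of_comparator`). The cost is controlled by a
one-sided second order bound Φ(L + s eᵢ) ≥ Φ(L) + pᵢ s - bᵢ s²/2: for κ = 1 it is at most ∑ bᵢ
xᵢ²/(2pᵢ) (`sum_grad_mul_le`). So bᵢ has to compensate the factor 1/pᵢ.

FTPL: pᵢ is the probability that arm i leads. Given the other perturbations this is a tail event for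
Zᵢ, and a hazard rate of at most h says that raising Lᵢ by s destroys at most a fraction hs of it.
Thus bᵢ = h pᵢ and c = Nh/2 (`HazardLE.le_ftplPotential_add_single`). The penalty K - Φ(0) is E max
Z - E Z, bounded by a + N E(Z - a)⁺ + E Z⁻ for any level a. Each family contains laws for which h
and these tails balance.

FTRL: for F = ∑ φ(pᵢ), the objective exceeds its minimum by at least a Bregman divergence, so
curvature m(p) of φ to the left of p yields bᵢ = 1/m(pᵢ)
(`IsSeparableRegularizer.le_potential_add_single`). Tsallis has 1/m = p^(2-α)/(ηα), so c ≤ N^α/(2αη)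
by Jensen, against a penalty η N^(1-α)/(1-α). The log-barrier has 1/m = p²/η, and the cost is at
most ∑ pᵢxᵢ/(2η), a fraction of the incurred loss itself. It is absorbed by κ = 1 - 1/(2η), which is
why that bound scales with the best loss instead of T. -/

namespace Bandit

/-! ### Action sequences, the tower property and the potential argument -/

section Paths

variable {N T : ℕ} {Φ : (Fin N → ℝ) → ℝ}

lemma cumEst_succ (Φ : (Fin N → ℝ) → ℝ) (ℓ : Fin T → Fin N → ℝ) (a : Fin T → Fin N) (t : Fin T) :
    cumEst Φ ℓ a (t + 1) = cumEst Φ ℓ a t +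
      Pi.single (a t) (ℓ t (a t) / grad Φ (cumEst Φ ℓ a t) (a t)) := by
  simp [cumEst]

/-- The estimate before round t only sees earlier actions, so the last action can be dropped; this
drives every induction on T. -/
lemma cumEst_snoc (Φ : (Fin N → ℝ) → ℝ) (ℓ : Fin (T + 1) → Fin N → ℝ) (a : Fin T → Fin N)
    (i : Fin N) (t : ℕ) (ht : t ≤ T) :
    cumEst Φ ℓ (Fin.snoc (α := fun _ => Fin N) a i) t
      = cumEst Φ (fun s : Fin T => ℓ s.castSucc) a t := by
  induction t with
  | zero => rfl
  | succ t ih =>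
    have h1 : t < T := ht
    have e1 := cumEst_succ Φ ℓ (Fin.snoc (α := fun _ => Fin N) a i) (Fin.castSucc ⟨t, h1⟩)
    have e2 := cumEst_succ Φ (fun s : Fin T => ℓ s.castSucc) a ⟨t, h1⟩
    simp only [Fin.val_castSucc, Fin.snoc_castSucc] at e1 e2
    rw [e1, e2, ih h1.le]

lemma cumEst_snoc_last (Φ : (Fin N → ℝ) → ℝ) (ℓ : Fin (T + 1) → Fin N → ℝ) (a : Fin T → Fin N)
    (i : Fin N) :
    cumEst Φ ℓ (Fin.snoc (α := fun _ => Fin N) a i) (T + 1)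
      = cumEst Φ (fun s : Fin T => ℓ s.castSucc) a T +
        Pi.single i (ℓ (Fin.last T) i /
          grad Φ (cumEst Φ (fun s : Fin T => ℓ s.castSucc) a T) i) := by
  have e1 := cumEst_succ Φ ℓ (Fin.snoc (α := fun _ => Fin N) a i) (Fin.last T)
  simp only [Fin.val_last, Fin.snoc_last] at e1
  rw [e1, cumEst_snoc Φ ℓ a i T le_rfl]

lemma pathProb_snoc (Φ : (Fin N → ℝ) → ℝ) (ℓ : Fin (T + 1) → Fin N → ℝ) (a : Fin T → Fin N)
    (i : Fin N) :
    pathProb Φ ℓ (Fin.snoc (α := fun _ => Fin N) a i)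
      = pathProb Φ (fun s : Fin T => ℓ s.castSucc) a *
        grad Φ (cumEst Φ (fun s : Fin T => ℓ s.castSucc) a T) i := by
  unfold pathProb playDist
  rw [Fin.prod_univ_castSucc]
  congr 1
  · refine Finset.prod_congr rfl fun t _ => ?_
    simp only [Fin.val_castSucc, Fin.snoc_castSucc]
    rw [cumEst_snoc Φ ℓ a i t t.isLt.le]
  · simp only [Fin.val_last, Fin.snoc_last]
    rw [cumEst_snoc Φ ℓ a i T le_rfl]

/-- Tower property: condition on all actions but the last. -/
lemma sum_pathProb_succ (Φ : (Fin N → ℝ) → ℝ) (ℓ : Fin (T + 1) → Fin N → ℝ)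
    (g : (Fin (T + 1) → Fin N) → ℝ) :
    ∑ a, pathProb Φ ℓ a * g a
      = ∑ a : Fin T → Fin N, pathProb Φ (fun s : Fin T => ℓ s.castSucc) a *
          ∑ i, grad Φ (cumEst Φ (fun s : Fin T => ℓ s.castSucc) a T) i *
            g (Fin.snoc (α := fun _ => Fin N) a i) := by
  rw [← (Fin.snocEquiv (fun _ : Fin (T + 1) => Fin N)).sum_comp, Fintype.sum_prod_type,
    Finset.sum_comm]
  refine Finset.sum_congr rfl fun a _ => ?_
  rw [Finset.mul_sum]
  refine Finset.sum_congr rfl fun i _ => ?_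
  have := pathProb_snoc Φ ℓ a i
  change pathProb Φ ℓ (Fin.snoc (α := fun _ => Fin N) a i) * _ = _
  rw [this, mul_assoc]
  rfl

lemma IsPotential.grad_nonneg (hΦ : IsPotential Φ) (L : Fin N → ℝ) (i : Fin N) :
    0 ≤ grad Φ L i := (hΦ.grad_mem L).1 i

lemma IsPotential.sum_grad (hΦ : IsPotential Φ) (L : Fin N → ℝ) : ∑ i, grad Φ L i = 1 :=
  (hΦ.grad_mem L).2

lemma pathProb_nonneg (hΦ : IsPotential Φ) (ℓ : Fin T → Fin N → ℝ) (a : Fin T → Fin N) :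
    0 ≤ pathProb Φ ℓ a :=
  Finset.prod_nonneg fun _ _ => hΦ.grad_nonneg _ _

lemma sum_pathProb (hΦ : IsPotential Φ) (ℓ : Fin T → Fin N → ℝ) : ∑ a, pathProb Φ ℓ a = 1 := by
  induction T with
  | zero => simp [pathProb]
  | succ T ih =>
    have h := sum_pathProb_succ Φ ℓ fun _ => 1
    simp only [mul_one, hΦ.sum_grad] at h
    rw [h, ih]

/-- The loss estimates never overestimate the losses in expectation. -/
lemma sum_pathProb_mul_cumEst_le (hΦ : IsPotential Φ) (ℓ : Fin T → Fin N → ℝ)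
    (hℓ : ∀ t i, 0 ≤ ℓ t i) (j : Fin N) :
    ∑ a, pathProb Φ ℓ a * cumEst Φ ℓ a T j ≤ ∑ t, ℓ t j := by
  induction T with
  | zero => simp [cumEst]
  | succ T ih =>
    rw [sum_pathProb_succ Φ ℓ fun a => cumEst Φ ℓ a (T + 1) j, Fin.sum_univ_castSucc]
    have ih' := ih (fun s : Fin T => ℓ s.castSucc) fun t i => hℓ _ _
    have hstep : ∀ a : Fin T → Fin N,
        ∑ i, grad Φ (cumEst Φ (fun s : Fin T => ℓ s.castSucc) a T) i *
          cumEst Φ ℓ (Fin.snoc (α := fun _ => Fin N) a i) (T + 1) j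
        ≤ cumEst Φ (fun s : Fin T => ℓ s.castSucc) a T j + ℓ (Fin.last T) j := by
      intro a
      set L := cumEst Φ (fun s : Fin T => ℓ s.castSucc) a T with hL
      have h1 : ∀ i, grad Φ L i * cumEst Φ ℓ (Fin.snoc (α := fun _ => Fin N) a i) (T + 1) j
          = grad Φ L i * L j +
            if j = i then grad Φ L i * (ℓ (Fin.last T) i / grad Φ L i) else 0 := by
        intro i
        rw [cumEst_snoc_last, ← hL, Pi.add_apply, Pi.single_apply, mul_add, mul_ite, mul_zero]
      simp only [h1, Finset.sum_add_distrib, ← Finset.sum_mul, hΦ.sum_grad, one_mul,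
        Finset.sum_ite_eq, Finset.mem_univ, if_true]
      gcongr
      -- An arm of probability 0 is never observed, and its estimate contributes 0. Only here is
      -- unbiasedness lost, in the harmless direction because losses are nonnegative.
      rcases eq_or_ne (grad Φ L j) 0 with h0 | h0
      · simp [h0, hℓ]
      · rw [mul_div_cancel₀ _ h0]
    calc _ ≤ ∑ a : Fin T → Fin N, pathProb Φ (fun s : Fin T => ℓ s.castSucc) a *
          (cumEst Φ (fun s : Fin T => ℓ s.castSucc) a T j + ℓ (Fin.last T) j) :=
          Finset.sum_le_sum fun a _ =>
            mul_le_mul_of_nonneg_left (hstep a) (pathProb_nonneg hΦ _ _)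
      _ ≤ _ := by
          simp only [mul_add, Finset.sum_add_distrib, ← Finset.sum_mul, sum_pathProb hΦ, one_mul]
          gcongr

/-- The potential argument: a bound on the loss incurred in one round in terms of the change of the
potential adds up over the rounds. -/
lemma expectedLoss_le_sum_potential (hΦ : IsPotential Φ) {κ c : ℝ}
    (hstep : ∀ (L x : Fin N → ℝ), (∀ i, x i ∈ Set.Icc (0 : ℝ) 1) →
      ∑ i, grad Φ L i * (κ * x i - Φ (L + Pi.single i (x i / grad Φ L i)) + Φ L) ≤ c)
    (ℓ : Fin T → Fin N → ℝ) (hℓ : UnitLosses ℓ) :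
    κ * expectedLoss Φ ℓ + Φ 0 ≤ ∑ a, pathProb Φ ℓ a * Φ (cumEst Φ ℓ a T) + T * c := by
  induction T with
  | zero => simp [expectedLoss, pathProb, cumEst]
  | succ T ih =>
    have ih' := ih (fun s : Fin T => ℓ s.castSucc) fun t i => hℓ _ _
    unfold expectedLoss at ih' ⊢
    rw [sum_pathProb_succ Φ ℓ fun a => Φ (cumEst Φ ℓ a (T + 1)),
      sum_pathProb_succ Φ ℓ fun a => ∑ t, ℓ t (a t)]
    have key : ∀ a : Fin T → Fin N,
        κ * (∑ i, grad Φ (cumEst Φ (fun s : Fin T => ℓ s.castSucc) a T) i *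
          ∑ t, ℓ t ((Fin.snoc (α := fun _ => Fin N) a i : Fin (T + 1) → Fin N) t)) ≤
        κ * (∑ t : Fin T, ℓ t.castSucc (a t)) -
          Φ (cumEst Φ (fun s : Fin T => ℓ s.castSucc) a T) +
        (∑ i, grad Φ (cumEst Φ (fun s : Fin T => ℓ s.castSucc) a T) i *
          Φ (cumEst Φ ℓ (Fin.snoc (α := fun _ => Fin N) a i) (T + 1))) + c := by
      intro a
      set L := cumEst Φ (fun s : Fin T => ℓ s.castSucc) a T with hL
      have h := hstep L (ℓ (Fin.last T)) fun i => hℓ _ _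
      have e1 : ∀ i, cumEst Φ ℓ (Fin.snoc (α := fun _ => Fin N) a i) (T + 1)
          = L + Pi.single i (ℓ (Fin.last T) i / grad Φ L i) := fun i => cumEst_snoc_last Φ ℓ a i
      have e2 : ∀ i, ∑ t, ℓ t ((Fin.snoc (α := fun _ => Fin N) a i : Fin (T + 1) → Fin N) t)
          = ∑ t : Fin T, ℓ t.castSucc (a t) + ℓ (Fin.last T) i := by
        intro i
        rw [Fin.sum_univ_castSucc]
        simp only [Fin.snoc_castSucc, Fin.snoc_last]
      simp only [e1, e2]
      simp only [mul_add, mul_sub, Finset.sum_add_distrib, Finset.sum_sub_distrib,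
        ← Finset.sum_mul, hΦ.sum_grad, one_mul] at h ⊢
      have e3 : ∑ i, grad Φ L i * (κ * ℓ (Fin.last T) i)
          = κ * ∑ i, grad Φ L i * ℓ (Fin.last T) i := by
        rw [Finset.mul_sum]; exact Finset.sum_congr rfl fun i _ => by ring
      rw [e3] at h
      linarith
    have key2 := Finset.sum_le_sum fun a (_ : a ∈ (Finset.univ : Finset (Fin T → Fin N))) =>
      mul_le_mul_of_nonneg_left (key a) (pathProb_nonneg hΦ (fun s : Fin T => ℓ s.castSucc) a)
    simp only [mul_add, mul_sub, Finset.sum_add_distrib, Finset.sum_sub_distrib,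
      ← Finset.sum_mul, sum_pathProb hΦ, one_mul] at key2
    have e4 : ∀ f : (Fin T → Fin N) → ℝ,
        ∑ a, pathProb Φ (fun s : Fin T => ℓ s.castSucc) a * (κ * f a)
          = κ * ∑ a, pathProb Φ (fun s : Fin T => ℓ s.castSucc) a * f a := by
      intro f
      rw [Finset.mul_sum]; exact Finset.sum_congr rfl fun i _ => by ring
    rw [e4, e4] at key2
    push_cast
    linarith

/-- The regret bound of the potential method against the mixed action `u`. -/
lemma expectedLoss_le_of_comparator (hΦ : IsPotential Φ) {κ c K : ℝ} {u : Fin N → ℝ}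
    (hu : ∀ i, 0 ≤ u i)
    (hstep : ∀ (L x : Fin N → ℝ), (∀ i, x i ∈ Set.Icc (0 : ℝ) 1) →
      ∑ i, grad Φ L i * (κ * x i - Φ (L + Pi.single i (x i / grad Φ L i)) + Φ L) ≤ c)
    (hcomp : ∀ L, Φ L ≤ ∑ i, u i * L i + K)
    (ℓ : Fin T → Fin N → ℝ) (hℓ : UnitLosses ℓ) :
    κ * expectedLoss Φ ℓ ≤ ∑ i, u i * ∑ t, ℓ t i + K - Φ 0 + T * c := by
  have h1 := expectedLoss_le_sum_potential hΦ hstep ℓ hℓ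
  have h2 : ∑ a, pathProb Φ ℓ a * Φ (cumEst Φ ℓ a T)
      ≤ ∑ a, pathProb Φ ℓ a * (∑ i, u i * cumEst Φ ℓ a T i + K) :=
    Finset.sum_le_sum fun a _ => mul_le_mul_of_nonneg_left (hcomp _) (pathProb_nonneg hΦ _ _)
  have h3 : ∑ a, pathProb Φ ℓ a * (∑ i, u i * cumEst Φ ℓ a T i + K)
      = ∑ i, u i * (∑ a, pathProb Φ ℓ a * cumEst Φ ℓ a T i) + K := by
    simp only [mul_add, Finset.sum_add_distrib, ← Finset.sum_mul, sum_pathProb hΦ, one_mul,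
      Finset.mul_sum]
    rw [Finset.sum_comm]
    congr 1
    exact Finset.sum_congr rfl fun i _ => Finset.sum_congr rfl fun a _ => by ring
  have h4 : ∑ i, u i * (∑ a, pathProb Φ ℓ a * cumEst Φ ℓ a T i) ≤ ∑ i, u i * ∑ t, ℓ t i :=
    Finset.sum_le_sum fun i _ => mul_le_mul_of_nonneg_left
      (sum_pathProb_mul_cumEst_le hΦ ℓ (fun t i => (hℓ t i).1) i) (hu i)
  linarith

lemma exists_bestLoss_eq [NeZero N] (ℓ : Fin T → Fin N → ℝ) : ∃ i, bestLoss ℓ = ∑ t, ℓ t i := by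
  obtain ⟨i, hi⟩ := exists_eq_ciInf_of_finite (f := fun i => ∑ t, ℓ t i)
  exact ⟨i, hi.symm⟩

/-- There is no regret if there is only one arm or no round. -/
lemma expectedRegret_eq_zero (hΦ : IsPotential Φ) (hN : 0 < N) (h : N = 1 ∨ T = 0)
    (ℓ : Fin T → Fin N → ℝ) : expectedRegret Φ ℓ = 0 := by
  have : NeZero N := ⟨hN.ne'⟩
  obtain ⟨i, hi⟩ := exists_bestLoss_eq ℓ
  have h1 : ∀ a : Fin T → Fin N, ∑ t, ℓ t (a t) = ∑ t, ℓ t i := by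
    intro a
    rcases h with rfl | rfl
    · exact Finset.sum_congr rfl fun t _ => by rw [Subsingleton.elim (a t) i]
    · simp
  rw [expectedRegret, hi, expectedLoss]
  simp only [h1, ← Finset.sum_mul, sum_pathProb hΦ, one_mul, sub_self]

/-- A second order lower bound on the potential along the coordinate axes bounds the loss of a
round in terms of the change of the potential. -/
lemma sum_grad_mul_le (hΦ : IsPotential Φ) {b : Fin N → ℝ} {L x : Fin N → ℝ}
    (hx : ∀ i, x i ∈ Set.Icc (0 : ℝ) 1) (κ : ℝ)
    (hb : ∀ i s, 0 ≤ s → 0 < grad Φ L i →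
      Φ L + grad Φ L i * s - b i * s ^ 2 / 2 ≤ Φ (L + Pi.single i s)) :
    ∑ i, grad Φ L i * (κ * x i - Φ (L + Pi.single i (x i / grad Φ L i)) + Φ L)
      ≤ ∑ i, if 0 < grad Φ L i then
          (b i * x i ^ 2 / (2 * grad Φ L i) - (1 - κ) * (grad Φ L i * x i)) else 0 := by
  refine Finset.sum_le_sum fun i _ => ?_
  split_ifs with h0
  · have h := hb i (x i / grad Φ L i) (div_nonneg (hx i).1 h0.le) h0
    rw [mul_div_cancel₀ _ h0.ne'] at h
    have h' := mul_le_mul_of_nonneg_left h h0.le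
    have e : grad Φ L i * (b i * (x i / grad Φ L i) ^ 2 / 2) = b i * x i ^ 2 / (2 * grad Φ L i) := by
      field_simp
    rw [mul_sub, e] at h'
    nlinarith
  · have : grad Φ L i = 0 := le_antisymm (not_lt.1 h0) (hΦ.grad_nonneg L i)
    simp [this]

end Paths

end Bandit

namespace Bandit

/-! ### FTRL with a separable regularizer -/

section Separable

open Set Asymptotics Filter Topology

/-- The normalization of the first order conditions `pᵢ = (c / (Lᵢ - λ)) ^ r` is solvable. -/
lemma exists_normalization {N : ℕ} (hN : 0 < N) (L : Fin N → ℝ) {c r : ℝ} (hc : 0 < c)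
    (hr : 1 ≤ r) : ∃ lam, (∀ i, lam < L i) ∧ ∑ i, (c / (L i - lam)) ^ r = 1 := by
  have : NeZero N := ⟨hN.ne'⟩
  obtain ⟨i₀, hi₀⟩ := Finite.exists_min L
  have hN1 : (1 : ℝ) ≤ N := by exact_mod_cast hN
  have hpos : ∀ x ∈ Icc (L i₀ - c * N) (L i₀ - c), ∀ i, 0 < L i - x := by
    intro x hx i
    have := hi₀ i; have := hx.2
    linarith
  have hcont : ContinuousOn (fun x => ∑ i, (c / (L i - x)) ^ r)
      (Icc (L i₀ - c * N) (L i₀ - c)) := by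
    refine continuousOn_finsetSum _ fun i _ => ContinuousOn.rpow_const ?_ ?_
    · refine continuousOn_const.div (by fun_prop) fun x hx => (hpos x hx i).ne'
    · intro x hx; right; linarith
  have hle : L i₀ - c * N ≤ L i₀ - c := by nlinarith
  -- At the left endpoint every ratio is at most 1/N, and r ≥ 1 only shrinks it; at the right
  -- endpoint the summand of the smallest Lᵢ is already 1.
  have h1 : ∑ i, (c / (L i - (L i₀ - c * N))) ^ r ≤ 1 := by
    calc ∑ i, (c / (L i - (L i₀ - c * N))) ^ r ≤ ∑ _i : Fin N, (1 : ℝ) / N := by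
          refine Finset.sum_le_sum fun i _ => ?_
          have hp := hpos _ (left_mem_Icc.2 hle) i
          have h2 : c / (L i - (L i₀ - c * N)) ≤ 1 / N := by
            rw [div_le_div_iff₀ hp (by linarith)]
            nlinarith [hi₀ i]
          have h3 : (1 : ℝ) / N ≤ 1 := by rw [div_le_one (by linarith)]; exact hN1
          calc _ ≤ (c / (L i - (L i₀ - c * N))) ^ (1 : ℝ) :=
                Real.rpow_le_rpow_of_exponent_ge (div_pos hc hp) (h2.trans h3) hr
            _ ≤ _ := by rwa [Real.rpow_one]
      _ = 1 := by
          rw [Finset.sum_const, Finset.card_univ, Fintype.card_fin, nsmul_eq_mul]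
          field_simp
  have h2 : 1 ≤ ∑ i, (c / (L i - (L i₀ - c))) ^ r := by
    have := Finset.single_le_sum (f := fun i => (c / (L i - (L i₀ - c))) ^ r)
      (fun i _ => Real.rpow_nonneg (div_nonneg hc.le (hpos _ (right_mem_Icc.2 hle) i).le) _)
      (Finset.mem_univ i₀)
    simpa [hc.ne'] using this
  obtain ⟨x, hx, hx1⟩ := intermediate_value_Icc hle hcont ⟨h1, h2⟩
  exact ⟨x, fun i => by have := hpos x hx i; linarith, hx1⟩

/-- Subtracting the linear term and the parabola from φ leaves a function with nonpositive
derivative on (q, p). Differentiability at q is not needed, which matters for the Tsallis summand at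
q = 0. -/
lemma add_quadratic_le_of_deriv_left {φ φ' : ℝ → ℝ} {p q k : ℝ} (hqp : q ≤ p)
    (hc : ContinuousOn φ (Icc q p)) (hd : ∀ x ∈ Ioo q p, HasDerivAt φ (φ' x) x)
    (hk : ∀ x ∈ Ioo q p, 2 * k * (p - x) ≤ φ' p - φ' x) :
    φ p + φ' p * (q - p) + k * (q - p) ^ 2 ≤ φ q := by
  have hder : ∀ x ∈ Ioo q p, HasDerivAt (fun x => φ x - φ' p * x - k * (x - p) ^ 2)
      (φ' x - φ' p * 1 - k * (2 * (x - p))) x := by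
    intro x hx
    have h := ((hasDerivAt_id x).sub_const p).pow 2
    simp only [id] at h
    have := ((hd x hx).sub ((hasDerivAt_id x).const_mul (φ' p))).sub (h.const_mul k)
    convert! this using 1
    ring
  have := antitoneOn_of_deriv_nonpos (convex_Icc q p)
    (f := fun x => φ x - φ' p * x - k * (x - p) ^ 2) (hc.sub (by fun_prop) |>.sub (by fun_prop))
    (fun x hx => by
      rw [interior_Icc] at hx; exact (hder x hx).differentiableAt.differentiableWithinAt)
    (fun x hx => by
      rw [interior_Icc] at hx; rw [(hder x hx).deriv]
      nlinarith [hk x hx])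
  have := this (left_mem_Icc.2 hqp) (right_mem_Icc.2 hqp) hqp
  simp only at this
  nlinarith

lemma add_quadratic_le_of_deriv_right {φ φ' : ℝ → ℝ} {p q k : ℝ} (hpq : p ≤ q)
    (hc : ContinuousOn φ (Icc p q)) (hd : ∀ x ∈ Ioo p q, HasDerivAt φ (φ' x) x)
    (hk : ∀ x ∈ Ioo p q, 2 * k * (x - p) ≤ φ' x - φ' p) :
    φ p + φ' p * (q - p) + k * (q - p) ^ 2 ≤ φ q := by
  have h := add_quadratic_le_of_deriv_left (φ := fun x => φ (-x)) (φ' := fun x => -φ' (-x))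
    (p := -p) (q := -q) (k := k) (neg_le_neg hpq)
    (hc.comp (by fun_prop) fun x hx => ⟨by linarith [hx.2], by linarith [hx.1]⟩)
    (fun x hx => by
      have := (hd (-x) ⟨by linarith [hx.2], by linarith [hx.1]⟩).comp x (hasDerivAt_neg x)
      simpa using! this)
    (fun x hx => by
      have := hk (-x) ⟨by linarith [hx.2], by linarith [hx.1]⟩
      simp only [neg_neg]; linarith)
  simp only [neg_neg] at h
  nlinarith

/-- A regularizer `F p = ∑ᵢ φ (pᵢ)` on a part `S` of the simplex such that `φ` is `μ`-strongly
convex, has curvature at least `m p` to the left of `p`, and the first order conditions for the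
minimum of `⟨p, L⟩ + F p` can be solved in `S`. -/
structure IsSeparableRegularizer {N : ℕ} (S : Set (Fin N → ℝ)) (F : (Fin N → ℝ) → ℝ)
    (φ φ' m : ℝ → ℝ) (μ : ℝ) : Prop where
  subset : S ⊆ stdSimplex ℝ (Fin N)
  eq_sum : ∀ p ∈ S, F p = ∑ i, φ (p i)
  pos : 0 < μ
  le_curvature : ∀ x, 0 < x → x ≤ 1 → μ ≤ m x
  growth_left : ∀ p ∈ S, ∀ q ∈ S, ∀ i, 0 < p i → q i ≤ p i →
    φ (p i) + φ' (p i) * (q i - p i) + m (p i) / 2 * (q i - p i) ^ 2 ≤ φ (q i)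
  growth_right : ∀ p ∈ S, ∀ q ∈ S, ∀ i, 0 < p i → p i ≤ q i →
    φ (p i) + φ' (p i) * (q i - p i) + μ / 2 * (q i - p i) ^ 2 ≤ φ (q i)
  exists_stationary : ∀ L : Fin N → ℝ, ∃ p ∈ S, (∀ i, 0 < p i) ∧ ∃ lam, ∀ i, φ' (p i) = lam - L i

namespace IsSeparableRegularizer

variable {N : ℕ} {S : Set (Fin N → ℝ)} {F : (Fin N → ℝ) → ℝ} {φ φ' m : ℝ → ℝ} {μ : ℝ}

lemma growth (h : IsSeparableRegularizer S F φ φ' m μ) {p q : Fin N → ℝ} (hp : p ∈ S)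
    (hq : q ∈ S) (i : Fin N) (hpi : 0 < p i) :
    φ (p i) + φ' (p i) * (q i - p i) + μ / 2 * (q i - p i) ^ 2 ≤ φ (q i) := by
  rcases le_total (q i) (p i) with h1 | h1
  · have := h.growth_left p hp q hq i hpi h1
    have h2 : p i ≤ 1 := by
      have := h.subset hp
      rw [← this.2]
      exact Finset.single_le_sum (f := p) (fun j _ => this.1 j) (Finset.mem_univ i)
    nlinarith [h.le_curvature _ hpi h2, sq_nonneg (q i - p i)]
  · exact h.growth_right p hp q hq i hpi h1

/-- A stationary point minimizes the objective, with the Bregman divergence as the margin. -/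
lemma objective_add_le (h : IsSeparableRegularizer S F φ φ' m μ) {L p q : Fin N → ℝ} (hp : p ∈ S)
    (hq : q ∈ S) {lam : ℝ} (hlam : ∀ i, φ' (p i) = lam - L i) :
    ftrlObjective F L p + ∑ i, (φ (q i) - φ (p i) - φ' (p i) * (q i - p i))
      ≤ ftrlObjective F L q := by
  -- The multiplier `lam` drops out because p and q have the same total mass.
  have h1 : ∑ i, φ' (p i) * (q i - p i) = ∑ i, p i * L i - ∑ i, q i * L i := by
    have : ∀ i, φ' (p i) * (q i - p i) = lam * q i - lam * p i + (p i * L i - q i * L i) := by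
      intro i; rw [hlam]; ring
    simp only [this, Finset.sum_add_distrib, Finset.sum_sub_distrib, ← Finset.mul_sum,
      (h.subset hp).2, (h.subset hq).2]
    ring
  unfold ftrlObjective
  rw [h.eq_sum p hp, h.eq_sum q hq, Finset.sum_sub_distrib, Finset.sum_sub_distrib, h1]
  linarith

lemma objective_add_sq_le (h : IsSeparableRegularizer S F φ φ' m μ) {L p q : Fin N → ℝ}
    (hp : p ∈ S) (hp0 : ∀ i, 0 < p i) (hq : q ∈ S) {lam : ℝ} (hlam : ∀ i, φ' (p i) = lam - L i) :
    ftrlObjective F L p + ∑ i, μ / 2 * (q i - p i) ^ 2 ≤ ftrlObjective F L q := by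
  refine le_trans ?_ (h.objective_add_le hp hq hlam)
  gcongr with i _
  linarith [h.growth hp hq i (hp0 i)]

lemma isMinOn (h : IsSeparableRegularizer S F φ φ' m μ) {L p : Fin N → ℝ}
    (hp : p ∈ S) (hp0 : ∀ i, 0 < p i) {lam : ℝ} (hlam : ∀ i, φ' (p i) = lam - L i) :
    IsMinOn (ftrlObjective F L) S p := by
  intro q hq
  have h1 := h.objective_add_sq_le hp hp0 hq hlam
  have h2 : 0 ≤ ∑ i, μ / 2 * (q i - p i) ^ 2 :=
    Finset.sum_nonneg fun i _ => mul_nonneg (by linarith [h.pos]) (sq_nonneg _)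
  simp only [mem_ofPred_eq]
  linarith

lemma minAttained (h : IsSeparableRegularizer S F φ φ' m μ) : MinAttained S F := by
  intro L
  obtain ⟨p, hp, hp0, lam, hlam⟩ := h.exists_stationary L
  exact ⟨p, hp, h.isMinOn hp hp0 hlam⟩

lemma potential_eq {L p : Fin N → ℝ} (hp : p ∈ S) (hmin : IsMinOn (ftrlObjective F L) S p) :
    ftrlPotential S F L = ftrlObjective F L p :=
  IsLeast.csInf_eq ⟨mem_image_of_mem _ hp, by rintro _ ⟨q, hq, rfl⟩; exact hmin hq⟩

lemma potential_le (h : IsSeparableRegularizer S F φ φ' m μ) (L : Fin N → ℝ) {q : Fin N → ℝ}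
    (hq : q ∈ S) : ftrlPotential S F L ≤ ftrlObjective F L q := by
  obtain ⟨p, hp, hmin⟩ := h.minAttained L
  rw [potential_eq hp hmin]
  exact hmin hq

/-- Envelope theorem with a quadratic error. Above, p stays feasible for L'. Below, the minimizer q
for L' pays μ/2 (q - p)² in the old objective, and completing the square against (q - p)(L' - L)
leaves an error of order ‖L' - L‖². Continuity of the minimizer is never needed. -/
lemma hasFDerivAt (h : IsSeparableRegularizer S F φ φ' m μ) {L p : Fin N → ℝ}
    (hp : p ∈ S) (hp0 : ∀ i, 0 < p i) {lam : ℝ} (hlam : ∀ i, φ' (p i) = lam - L i) :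
    HasFDerivAt (ftrlPotential S F)
      (∑ i, p i • (ContinuousLinearMap.proj i : (Fin N → ℝ) →L[ℝ] ℝ)) L := by
  have hμ := h.pos
  refine HasFDerivAt.of_isLittleO ?_
  refine IsBigO.trans_isLittleO (g := fun L' => ‖L' - L‖ ^ 2) ?_
    (isLittleO_pow_sub_sub L one_lt_two)
  refine IsBigO.of_bound (N * (1 / (2 * μ))) (Eventually.of_forall fun L' => ?_)
  obtain ⟨q, hq, hmin⟩ := h.minAttained L'
  have e1 := potential_eq hp (h.isMinOn hp hp0 hlam)
  have e2 := potential_eq hq hmin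
  have h1 : ftrlPotential S F L' ≤ ftrlObjective F L' p := h.potential_le L' hp
  have h2 := h.objective_add_sq_le hp hp0 hq hlam
  have e3 : ∀ r : Fin N → ℝ,
      ftrlObjective F L' r = ftrlObjective F L r + ∑ i, r i * (L' i - L i) := by
    intro r
    simp only [ftrlObjective, mul_sub, Finset.sum_sub_distrib]
    ring
  have e4 : (∑ i, p i • (ContinuousLinearMap.proj i : (Fin N → ℝ) →L[ℝ] ℝ)) (L' - L)
      = ∑ i, p i * (L' i - L i) := by
    simp
  rw [e3] at h1 e2
  rw [e4, norm_pow, norm_norm, Real.norm_eq_abs, abs_le]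
  have h3 : ∑ i, p i * (L' i - L i) - N * (1 / (2 * μ)) * ‖L' - L‖ ^ 2
      ≤ ∑ i, μ / 2 * (q i - p i) ^ 2 + ∑ i, q i * (L' i - L i) := by
    have : (N : ℝ) * (1 / (2 * μ)) * ‖L' - L‖ ^ 2
        = ∑ _i : Fin N, 1 / (2 * μ) * ‖L' - L‖ ^ 2 := by
      rw [Finset.sum_const, Finset.card_univ, Fintype.card_fin, nsmul_eq_mul]; ring
    rw [this, ← Finset.sum_sub_distrib, ← Finset.sum_add_distrib]
    refine Finset.sum_le_sum fun i _ => ?_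
    have hn : |L' i - L i| ≤ ‖L' - L‖ := norm_le_pi_norm (L' - L) i
    have h5 : (L' i - L i) ^ 2 ≤ ‖L' - L‖ ^ 2 := by
      rw [← sq_abs]; gcongr
    have h6 : 1 / (2 * μ) * (L' i - L i) ^ 2 ≤ 1 / (2 * μ) * ‖L' - L‖ ^ 2 := by gcongr
    have h7 : 0 ≤ 1 / (2 * μ) * (μ * (q i - p i) + (L' i - L i)) ^ 2 := by positivity
    have h8 : 1 / (2 * μ) * (μ * (q i - p i) + (L' i - L i)) ^ 2
      = μ / 2 * (q i - p i) ^ 2 + (q i - p i) * (L' i - L i)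
        + 1 / (2 * μ) * (L' i - L i) ^ 2 := by
      field_simp; ring
    nlinarith
  have h9 : 0 ≤ (N : ℝ) * (1 / (2 * μ)) * ‖L' - L‖ ^ 2 := by positivity
  constructor <;> linarith

lemma grad_eq (h : IsSeparableRegularizer S F φ φ' m μ) {L p : Fin N → ℝ}
    (hp : p ∈ S) (hp0 : ∀ i, 0 < p i) {lam : ℝ} (hlam : ∀ i, φ' (p i) = lam - L i) :
    grad (ftrlPotential S F) L = p := by
  ext i
  rw [grad, (h.hasFDerivAt hp hp0 hlam).fderiv]
  simp [Pi.single_apply]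

lemma isPotential (h : IsSeparableRegularizer S F φ φ' m μ) :
    IsPotential (ftrlPotential S F) where
  concave := by
    refine ⟨convex_univ, fun x _ y _ a b ha hb hab => ?_⟩
    obtain ⟨p, hp, hmin⟩ := h.minAttained (a • x + b • y)
    rw [potential_eq hp hmin]
    have e : ftrlObjective F (a • x + b • y) p
        = a * ftrlObjective F x p + b * ftrlObjective F y p := by
      have e1 : ∀ i, p i * (a • x + b • y) i = a * (p i * x i) + b * (p i * y i) := by
        intro i; simp only [Pi.add_apply, Pi.smul_apply, smul_eq_mul]; ring
      have e2 : F p = a * F p + b * F p := by rw [← add_mul, hab, one_mul]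
      unfold ftrlObjective
      simp only [e1, Finset.sum_add_distrib, ← Finset.mul_sum]
      linarith
    rw [e]
    exact add_le_add (mul_le_mul_of_nonneg_left (h.potential_le x hp) ha)
      (mul_le_mul_of_nonneg_left (h.potential_le y hp) hb)
  differentiable := fun L => by
    obtain ⟨p, hp, hp0, lam, hlam⟩ := h.exists_stationary L
    exact (h.hasFDerivAt hp hp0 hlam).differentiableAt
  grad_mem := fun L => by
    obtain ⟨p, hp, hp0, lam, hlam⟩ := h.exists_stationary L
    rw [h.grad_eq hp hp0 hlam]
    exact h.subset hp

lemma grad_pos (h : IsSeparableRegularizer S F φ φ' m μ) (L : Fin N → ℝ) (i : Fin N) :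
    0 < grad (ftrlPotential S F) L i := by
  obtain ⟨p, hp, hp0, lam, hlam⟩ := h.exists_stationary L
  rw [h.grad_eq hp hp0 hlam]
  exact hp0 i

/-- The second order lower bound on the potential along the coordinate axes. -/
lemma le_potential_add_single (h : IsSeparableRegularizer S F φ φ' m μ) (L : Fin N → ℝ)
    (i : Fin N) {s : ℝ} (hs : 0 ≤ s) :
    ftrlPotential S F L + grad (ftrlPotential S F) L i * s
      - (1 / m (grad (ftrlPotential S F) L i)) * s ^ 2 / 2
      ≤ ftrlPotential S F (L + Pi.single i s) := by
  obtain ⟨p, hp, hp0, lam, hlam⟩ := h.exists_stationary L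
  obtain ⟨q, hq, hmin⟩ := h.minAttained (L + Pi.single i s)
  rw [h.grad_eq hp hp0 hlam, potential_eq hp (h.isMinOn hp hp0 hlam), potential_eq hq hmin]
  have e : ftrlObjective F (L + Pi.single i s) q = ftrlObjective F L q + q i * s := by
    simp [ftrlObjective, mul_add, Finset.sum_add_distrib, Pi.single_apply]
    ring
  have h1 := h.objective_add_le hp hq hlam
  have h2 : φ (q i) - φ (p i) - φ' (p i) * (q i - p i)
      ≤ ∑ i, (φ (q i) - φ (p i) - φ' (p i) * (q i - p i)) := by
    refine Finset.single_le_sum (f := fun i => φ (q i) - φ (p i) - φ' (p i) * (q i - p i))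
      (fun j _ => ?_) (Finset.mem_univ i)
    have := h.growth hp hq j (hp0 j)
    nlinarith [h.pos, mul_nonneg h.pos.le (sq_nonneg (q j - p j))]
  have hpi : p i ≤ 1 := by
    have := h.subset hp
    rw [← this.2]
    exact Finset.single_le_sum (f := p) (fun j _ => this.1 j) (Finset.mem_univ i)
  have hm : 0 < m (p i) := h.pos.trans_le (h.le_curvature _ (hp0 i) hpi)
  have h3 : (p i - q i) * s - (1 / m (p i)) * s ^ 2 / 2
      ≤ φ (q i) - φ (p i) - φ' (p i) * (q i - p i) := by
    -- Raising Lᵢ should lower the weight of arm i: if qᵢ ≤ pᵢ, complete the square with the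
    -- curvature m(pᵢ). If qᵢ ≥ pᵢ, the left side is nonpositive, so convexity suffices and strong
    -- curvature is needed on one side only.
    rcases le_total (q i) (p i) with hqp | hqp
    · have h4 := h.growth_left p hp q hq i (hp0 i) hqp
      have h5 : 0 ≤ 1 / (2 * m (p i)) * (m (p i) * (q i - p i) + s) ^ 2 := by positivity
      have h6 : 1 / (2 * m (p i)) * (m (p i) * (q i - p i) + s) ^ 2
        = m (p i) / 2 * (q i - p i) ^ 2 + (q i - p i) * s + (1 / m (p i)) * s ^ 2 / 2 := by
        field_simp; ring
      linarith
    · have h4 := h.growth_right p hp q hq i (hp0 i) hqp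
      have h5 : 0 ≤ (1 / m (p i)) * s ^ 2 / 2 := by positivity
      have h6 : 0 ≤ μ / 2 * (q i - p i) ^ 2 := mul_nonneg (by linarith [h.pos]) (sq_nonneg _)
      nlinarith [mul_nonneg (sub_nonneg.2 hqp) hs]
  rw [e]
  linarith

end IsSeparableRegularizer

end Separable

/-! ### The Tsallis entropy and the log-barrier as separable regularizers -/

section Regularizers

open Set

/-- Convexity of x^(α-1). Scaling reduces it to p = 1, where Bernoulli gives u^(1-α) ≤ 1 + y with y
= (1-α)(u-1), and (1 - y)(1 + y) ≤ 1 handles the inverse. -/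
lemma rpow_tangent_le {α p x : ℝ} (h0 : 0 < α) (h1 : α < 1) (hp : 0 < p) (hx : 0 < x) :
    p ^ (α - 1) - (1 - α) * p ^ (α - 2) * (x - p) ≤ x ^ (α - 1) := by
  obtain ⟨u, hu, rfl⟩ : ∃ u, 0 < u ∧ x = p * u := ⟨x / p, div_pos hx hp, by field_simp⟩
  have hb := rpow_one_add_le_one_add_mul_self (s := u - 1) (p := 1 - α) (by linarith)
    (by linarith) (by linarith)
  rw [add_sub_cancel] at hb
  have hup : 0 < u ^ (1 - α) := Real.rpow_pos_of_pos hu _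
  have hinv : 1 - (1 - α) * (u - 1) ≤ u ^ (α - 1) := by
    have e : u ^ (α - 1) = (u ^ (1 - α))⁻¹ := by rw [← Real.rpow_neg hu.le, neg_sub]
    rw [e, ← one_div, le_div_iff₀ hup]
    rcases le_or_gt (1 - (1 - α) * (u - 1)) 0 with h | h
    · nlinarith
    · nlinarith [sq_nonneg ((1 - α) * (u - 1))]
  have hpp : 0 < p ^ (α - 1) := Real.rpow_pos_of_pos hp _
  have e2 : p ^ (α - 2) * p = p ^ (α - 1) := by
    rw [← Real.rpow_add_one hp.ne']; ring_nf
  rw [Real.mul_rpow hp.le hu.le]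
  calc p ^ (α - 1) - (1 - α) * p ^ (α - 2) * (p * u - p)
      = p ^ (α - 1) - (1 - α) * (p ^ (α - 2) * p) * (u - 1) := by ring
    _ = p ^ (α - 1) * (1 - (1 - α) * (u - 1)) := by rw [e2]; ring
    _ ≤ _ := by gcongr

lemma mem_Icc_of_mem_stdSimplex {N : ℕ} {p : Fin N → ℝ} (hp : p ∈ stdSimplex ℝ (Fin N))
    (i : Fin N) : p i ∈ Icc (0 : ℝ) 1 := by
  refine ⟨hp.1 i, ?_⟩
  rw [← hp.2]
  exact Finset.single_le_sum (f := p) (fun j _ => hp.1 j) (Finset.mem_univ i)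

lemma mul_tsallisLog_one_div {α x : ℝ} (h0 : 0 < α) (h1 : α < 1) (hx : 0 ≤ x) :
    x * tsallisLog α (1 / x) = (x ^ α - x) / (1 - α) := by
  rw [tsallisLog, if_neg h1.ne]
  rcases hx.eq_or_lt with rfl | hx
  · simp [h0.ne']
  · rw [one_div, Real.inv_rpow hx.le, ← Real.rpow_neg hx.le, neg_sub, mul_div_assoc', mul_sub,
      mul_one, Real.rpow_sub_one hx.ne', mul_div_cancel₀ _ hx.ne']

lemma tsallisNegEntropy_eq {N : ℕ} {α : ℝ} (η : ℝ) (h0 : 0 < α) (h1 : α < 1) {p : Fin N → ℝ}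
    (hp : p ∈ stdSimplex ℝ (Fin N)) :
    tsallisNegEntropy α η p = ∑ i, η / (1 - α) * (p i - p i ^ α) := by
  rw [tsallisNegEntropy, Finset.mul_sum]
  refine Finset.sum_congr rfl fun i _ => ?_
  rw [mul_tsallisLog_one_div h0 h1 (hp.1 i)]
  ring

/-- Here φ'' = ηα x^(α-2) is decreasing: to the left of p it is at least its value at p, and on (0,
1] it is at least ηα. Solving φ'(pᵢ) = const - Lᵢ gives pᵢ = (c/(Lᵢ - λ))^(1/(1-α)) with c =
ηα/(1-α), automatically positive. -/
lemma isSeparableRegularizer_tsallis {N : ℕ} (hN : 0 < N) {α η : ℝ} (h0 : 0 < α) (h1 : α < 1)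
    (hη : 0 < η) :
    IsSeparableRegularizer (stdSimplex ℝ (Fin N)) (tsallisNegEntropy α η)
      (fun x => η / (1 - α) * (x - x ^ α)) (fun x => η / (1 - α) * (1 - α * x ^ (α - 1)))
      (fun x => η * α * x ^ (α - 2)) (η * α) := by
  have hα : 0 < 1 - α := by linarith
  have hder : ∀ x : ℝ, 0 < x → HasDerivAt (fun x : ℝ => η / (1 - α) * (x - x ^ α))
      (η / (1 - α) * (1 - α * x ^ (α - 1))) x := fun x hx =>
    ((hasDerivAt_id x).sub (Real.hasDerivAt_rpow_const (Or.inl hx.ne'))).const_mul _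
  have hcont : Continuous fun x : ℝ => η / (1 - α) * (x - x ^ α) :=
    continuous_const.mul (continuous_id.sub (Real.continuous_rpow_const h0.le))
  have hdiff : ∀ x y : ℝ, η / (1 - α) * (1 - α * x ^ (α - 1)) - η / (1 - α) * (1 - α * y ^ (α - 1))
      = η * α / (1 - α) * (y ^ (α - 1) - x ^ (α - 1)) := fun x y => by ring
  refine ⟨subset_rfl, fun p hp => tsallisNegEntropy_eq η h0 h1 hp, by positivity, ?_, ?_, ?_, ?_⟩
  · intro x hx hx1
    have : 1 ≤ x ^ (α - 2) := Real.one_le_rpow_of_pos_of_le_one_of_nonpos hx hx1 (by linarith)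
    nlinarith [mul_pos hη h0]
  · intro p hp q hq i hpi hqp
    refine add_quadratic_le_of_deriv_left (φ := fun x => η / (1 - α) * (x - x ^ α))
      (φ' := fun x => η / (1 - α) * (1 - α * x ^ (α - 1))) hqp hcont.continuousOn
      (fun x hx => hder x ((hq.1 i).trans_lt hx.1)) fun x hx => ?_
    have hx0 : 0 < x := (hq.1 i).trans_lt hx.1
    rw [hdiff, div_mul_eq_mul_div, le_div_iff₀ hα]
    nlinarith [mul_le_mul_of_nonneg_left (rpow_tangent_le h0 h1 hpi hx0) (mul_pos hη h0).le]
  · intro p hp q hq i hpi hpq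
    refine add_quadratic_le_of_deriv_right (φ := fun x => η / (1 - α) * (x - x ^ α))
      (φ' := fun x => η / (1 - α) * (1 - α * x ^ (α - 1))) hpq hcont.continuousOn
      (fun x hx => hder x (hpi.trans hx.1)) fun x hx => ?_
    have hx0 : 0 < x := hpi.trans hx.1
    have hx1 : x ≤ 1 := hx.2.le.trans (mem_Icc_of_mem_stdSimplex hq i).2
    have h2 : 1 ≤ x ^ (α - 2) := Real.one_le_rpow_of_pos_of_le_one_of_nonpos hx0 hx1 (by linarith)
    have h3 := rpow_tangent_le h0 h1 hx0 hpi
    have h4 : (1 - α) * (x - p i) ≤ p i ^ (α - 1) - x ^ (α - 1) := by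
      have : 0 ≤ (1 - α) * (x - p i) := mul_nonneg hα.le (by linarith [hx.1])
      nlinarith [mul_le_mul_of_nonneg_left h2 this]
    rw [hdiff, div_mul_eq_mul_div, le_div_iff₀ hα]
    nlinarith [mul_le_mul_of_nonneg_left h4 (mul_pos hη h0).le]
  · intro L
    have hc : 0 < η * α / (1 - α) := by positivity
    obtain ⟨lam, hlam, hsum⟩ := exists_normalization hN L hc (r := 1 / (1 - α))
      (by rw [le_div_iff₀ hα]; linarith)
    have hy : ∀ i, 0 < η * α / (1 - α) / (L i - lam) := fun i => div_pos hc (by linarith [hlam i])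
    refine ⟨fun i => (η * α / (1 - α) / (L i - lam)) ^ (1 / (1 - α)),
      ⟨fun i => Real.rpow_nonneg (hy i).le _, hsum⟩, fun i => Real.rpow_pos_of_pos (hy i) _,
      lam + η / (1 - α), fun i => ?_⟩
    have e : 1 / (1 - α) * (α - 1) = -1 := by field_simp; ring
    have hLi : L i - lam ≠ 0 := by linarith [hlam i]
    simp only
    rw [← Real.rpow_mul (hy i).le, e, Real.rpow_neg_one]
    field_simp
    ring

/-- The same scheme with φ'' = η/x², again decreasing and at least η on (0, 1]; the stationary point
is pᵢ = η/(Lᵢ - λ). -/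
lemma isSeparableRegularizer_logBarrier {N : ℕ} (hN : 0 < N) {η : ℝ} (hη : 0 < η) :
    IsSeparableRegularizer (openSimplex N) (logBarrier η)
      (fun x => -η * Real.log x) (fun x => -η * x⁻¹) (fun x => η / x ^ 2) η := by
  have hder : ∀ x : ℝ, 0 < x → HasDerivAt (fun x : ℝ => -η * Real.log x) (-η * x⁻¹) x :=
    fun x hx => (Real.hasDerivAt_log hx.ne').const_mul _
  have hcont : ∀ a b : ℝ, 0 < a → ContinuousOn (fun x : ℝ => -η * Real.log x) (Icc a b) :=
    fun a b ha x hx => (hder x (ha.trans_le hx.1)).continuousAt.continuousWithinAt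
  refine ⟨fun p hp => hp.1, fun p _ => by rw [logBarrier, Finset.mul_sum], hη, ?_, ?_, ?_, ?_⟩
  · intro x hx hx1
    rw [le_div_iff₀ (by positivity)]
    nlinarith [mul_nonneg hη.le (sub_nonneg.2 (show x ^ 2 ≤ 1 by nlinarith))]
  · intro p hp q hq i hpi hqp
    refine add_quadratic_le_of_deriv_left (φ := fun x => -η * Real.log x)
      (φ' := fun x => -η * x⁻¹) hqp (hcont _ _ (hq.2 i))
      (fun x hx => hder x ((hq.2 i).trans hx.1)) fun x hx => ?_
    have hx0 : 0 < x := (hq.2 i).trans hx.1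
    have e : -η * (p i)⁻¹ - -η * x⁻¹ - 2 * (η / p i ^ 2 / 2) * (p i - x)
      = η * (p i - x) ^ 2 / (p i ^ 2 * x) := by field_simp; ring
    have : 0 ≤ η * (p i - x) ^ 2 / (p i ^ 2 * x) := by positivity
    linarith
  · intro p hp q hq i hpi hpq
    refine add_quadratic_le_of_deriv_right (φ := fun x => -η * Real.log x)
      (φ' := fun x => -η * x⁻¹) hpq (hcont _ _ hpi)
      (fun x hx => hder x (hpi.trans hx.1)) fun x hx => ?_
    have hx0 : 0 < x := hpi.trans hx.1
    have hx1 : x ≤ 1 := hx.2.le.trans (mem_Icc_of_mem_stdSimplex hq.1 i).2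
    have hp1 := (mem_Icc_of_mem_stdSimplex hp.1 i).2
    have e : -η * x⁻¹ - -η * (p i)⁻¹ - 2 * (η / 2) * (x - p i)
      = η * (x - p i) * (1 - p i * x) / (p i * x) := by field_simp; ring
    have : 0 ≤ η * (x - p i) * (1 - p i * x) / (p i * x) := by
      refine div_nonneg (mul_nonneg (mul_nonneg hη.le (by linarith [hx.1])) ?_) (by positivity)
      nlinarith
    linarith
  · intro L
    obtain ⟨lam, hlam, hsum⟩ := exists_normalization hN L hη le_rfl
    have hy : ∀ i, 0 < η / (L i - lam) := fun i => div_pos hη (by linarith [hlam i])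
    simp only [Real.rpow_one] at hsum
    refine ⟨fun i => η / (L i - lam), ⟨⟨fun i => (hy i).le, hsum⟩, hy⟩, hy, lam, fun i => ?_⟩
    have hLi : L i - lam ≠ 0 := by linarith [hlam i]
    simp only
    field_simp
    ring

end Regularizers

end Bandit

namespace Bandit

/-! ### Regret of FTRL -/

section FTRLRegret

open Set

/-- Jensen for the concave function x^β, with uniform weights on the coordinates. -/
lemma sum_rpow_le {N : ℕ} (hN : 0 < N) {β : ℝ} (h0 : 0 ≤ β) (h1 : β ≤ 1) {p : Fin N → ℝ}
    (hp : p ∈ stdSimplex ℝ (Fin N)) : ∑ i, p i ^ β ≤ (N : ℝ) ^ (1 - β) := by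
  have hN0 : (0 : ℝ) < N := by exact_mod_cast hN
  have h := (Real.concaveOn_rpow h0 h1).le_map_sum (t := (Finset.univ : Finset (Fin N)))
    (w := fun _ => (1 : ℝ) / N) (p := p) (fun _ _ => by positivity)
    (by rw [Finset.sum_const, Finset.card_univ, Fintype.card_fin, nsmul_eq_mul]; field_simp)
    (fun i _ => hp.1 i)
  simp only [smul_eq_mul, ← Finset.mul_sum, hp.2, mul_one] at h
  rw [one_div, inv_mul_le_iff₀ hN0, Real.inv_rpow hN0.le, ← Real.rpow_neg hN0.le] at h
  rwa [sub_eq_add_neg, Real.rpow_add hN0, Real.rpow_one]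

/-- The comparator is the vertex of the best arm, where the entropy vanishes, so K = 0. The first
term is -Φ(0), the second the accumulated cost ∑ p^(1-α)/(2αη) per round; `sum_rpow_le` bounds both.
-/
lemma tsallis_regret_le {N T : ℕ} (hN : 0 < N) {α η : ℝ} (h0 : 0 < α) (h1 : α < 1) (hη : 0 < η)
    (ℓ : Fin T → Fin N → ℝ) (hℓ : UnitLosses ℓ) :
    expectedRegret (tsallisPotential N α η) ℓ
      ≤ η * (N : ℝ) ^ (1 - α) / (1 - α) + T * (N : ℝ) ^ α / (2 * α * η) := by
  have : NeZero N := ⟨hN.ne'⟩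
  have hα : 0 < 1 - α := by linarith
  have hreg := isSeparableRegularizer_tsallis hN h0 h1 hη
  have hΦ : IsPotential (tsallisPotential N α η) := hreg.isPotential
  obtain ⟨i, hi⟩ := exists_bestLoss_eq ℓ
  have hmem : Pi.single i (1 : ℝ) ∈ stdSimplex ℝ (Fin N) := single_mem_stdSimplex ℝ i
  have hF : tsallisNegEntropy α η (Pi.single i (1 : ℝ) : Fin N → ℝ) = 0 := by
    rw [tsallisNegEntropy_eq η h0 h1 hmem]
    refine Finset.sum_eq_zero fun j _ => ?_
    rcases eq_or_ne j i with rfl | hj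
    · simp
    · simp [hj, h0.ne']
  have hzero : -(tsallisPotential N α η 0) ≤ η * (N : ℝ) ^ (1 - α) / (1 - α) := by
    obtain ⟨p, hp, hmin⟩ := hreg.minAttained 0
    rw [tsallisPotential, IsSeparableRegularizer.potential_eq hp hmin, ftrlObjective,
      tsallisNegEntropy_eq η h0 h1 hp, ← Finset.mul_sum, Finset.sum_sub_distrib, hp.2]
    have := sum_rpow_le hN h0.le h1.le hp
    have h2 : η / (1 - α) * ∑ i, p i ^ α ≤ η / (1 - α) * (N : ℝ) ^ (1 - α) := by gcongr
    have h3 : 0 < η / (1 - α) := by positivity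
    simp only [Pi.zero_apply, mul_zero, Finset.sum_const_zero]
    rw [mul_div_right_comm]
    linarith
  have hmain := expectedLoss_le_of_comparator hΦ (κ := 1) (c := (N : ℝ) ^ α / (2 * α * η)) (K := 0)
    (u := Pi.single i (1 : ℝ)) (fun j => hmem.1 j)
    (fun L x hx => by
      refine (sum_grad_mul_le hΦ hx 1 fun j s hs _ => hreg.le_potential_add_single L j hs).trans ?_
      have h2 : ∀ j, (if 0 < grad (tsallisPotential N α η) L j then
          (1 / (η * α * grad (tsallisPotential N α η) L j ^ (α - 2)) * x j ^ 2
            / (2 * grad (tsallisPotential N α η) L j)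
            - (1 - 1) * (grad (tsallisPotential N α η) L j * x j)) else 0)
          ≤ 1 / (2 * α * η) * grad (tsallisPotential N α η) L j ^ (1 - α) := by
        intro j
        have hp := hreg.grad_pos L j
        change 0 < grad (tsallisPotential N α η) L j at hp
        rw [if_pos hp]
        set p := grad (tsallisPotential N α η) L j
        have e : p ^ (1 - α) = 1 / (p ^ (α - 2) * p) := by
          rw [← Real.rpow_add_one hp.ne', one_div, ← Real.rpow_neg hp.le]
          ring_nf
        have hx2 : x j ^ 2 ≤ 1 := by have := hx j; nlinarith [this.1, this.2]
        have hpp : 0 < p ^ (α - 2) := Real.rpow_pos_of_pos hp _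
        rw [e]
        calc _ = 1 / (2 * α * η) * (1 / (p ^ (α - 2) * p)) * x j ^ 2 := by field_simp; ring
          _ ≤ 1 / (2 * α * η) * (1 / (p ^ (α - 2) * p)) * 1 := by gcongr
          _ = _ := mul_one _
      refine (Finset.sum_le_sum fun j _ => h2 j).trans ?_
      rw [← Finset.mul_sum, one_div_mul_eq_div]
      have h3 := sum_rpow_le hN hα.le (by linarith) (hΦ.grad_mem L)
      rw [sub_sub_cancel] at h3
      gcongr)
    (fun L => by
      have := hreg.potential_le L hmem
      rw [ftrlObjective, hF] at this
      exact this) ℓ hℓ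
  simp only [Pi.single_apply, ite_mul, one_mul, zero_mul, Finset.sum_ite_eq', Finset.mem_univ,
    if_true] at hmain
  rw [expectedRegret, hi, mul_div_assoc (T : ℝ)]
  linarith

lemma exists_tsallis_regret_le {α : ℝ} (h0 : 0 < α) (h1 : α < 1) :
    ∃ C : ℝ, ∀ N T : ℕ, 0 < N → ∃ η : ℝ, 0 < η ∧
      MinAttained (stdSimplex ℝ (Fin N)) (tsallisNegEntropy α η) ∧
      IsPotential (tsallisPotential N α η) ∧
      ∀ ℓ : Fin T → Fin N → ℝ, UnitLosses ℓ →
        expectedRegret (tsallisPotential N α η) ℓ ≤ C * Real.sqrt ((N : ℝ) * (T : ℝ)) := by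
  refine ⟨1 / (1 - α) + 1 / (2 * α), fun N T hN => ?_⟩
  have hα : 0 < 1 - α := by linarith
  have hN0 : (0 : ℝ) < N := by exact_mod_cast hN
  rcases Nat.eq_zero_or_pos T with rfl | hT
  · have hreg := isSeparableRegularizer_tsallis hN h0 h1 one_pos
    refine ⟨1, one_pos, hreg.minAttained, hreg.isPotential, fun ℓ _ => ?_⟩
    rw [expectedRegret_eq_zero (Φ := tsallisPotential N α 1) hreg.isPotential hN (Or.inr rfl)]
    simp
  have hT0 : (0 : ℝ) < T := by exact_mod_cast hT
  -- This value makes both terms of `tsallis_regret_le` constant multiples of √(NT). It would be 0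
  -- for T = 0, hence the separate case above.
  set η := Real.sqrt T * (N : ℝ) ^ (α - 1 / 2) with hη_def
  have hη : 0 < η := by positivity
  have hreg := isSeparableRegularizer_tsallis hN h0 h1 hη
  refine ⟨η, hη, hreg.minAttained, hreg.isPotential, fun ℓ hℓ => ?_⟩
  refine (tsallis_regret_le hN h0 h1 hη ℓ hℓ).trans_eq ?_
  have e1 : η * (N : ℝ) ^ (1 - α) = Real.sqrt (N * T) := by
    rw [hη_def, mul_assoc, ← Real.rpow_add hN0, mul_comm (N : ℝ), Real.sqrt_mul hT0.le,
      Real.sqrt_eq_rpow N]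
    ring_nf
  have e2 : T * (N : ℝ) ^ α = Real.sqrt (N * T) * η := by
    rw [hη_def, mul_comm (N : ℝ), Real.sqrt_mul hT0.le, Real.sqrt_eq_rpow N]
    calc T * (N : ℝ) ^ α = (Real.sqrt T * Real.sqrt T) * ((N : ℝ) ^ (1 / 2 : ℝ) *
          (N : ℝ) ^ (α - 1 / 2)) := by
          rw [Real.mul_self_sqrt hT0.le, ← Real.rpow_add hN0]; ring_nf
      _ = _ := by ring
  rw [e1, e2]
  field_simp

lemma logBarrier_nonneg {N : ℕ} {η : ℝ} (hη : 0 ≤ η) {p : Fin N → ℝ}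
    (hp : p ∈ stdSimplex ℝ (Fin N)) : 0 ≤ logBarrier η p := by
  rw [logBarrier, neg_mul, Left.nonneg_neg_iff]
  refine mul_nonpos_of_nonneg_of_nonpos hη (Finset.sum_nonpos fun i _ => ?_)
  exact Real.log_nonpos (mem_Icc_of_mem_stdSimplex hp i).1 (mem_Icc_of_mem_stdSimplex hp i).2

lemma logBarrier_expectedLoss_le {N T : ℕ} (hN : 0 < N) (hT : 0 < T) {η : ℝ} (hη : 0 < η)
    (ℓ : Fin T → Fin N → ℝ) (hℓ : UnitLosses ℓ) :
    (1 - 1 / (2 * η)) * expectedLoss (logBarrierPotential N η) ℓ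
      ≤ bestLoss ℓ + 1 + η * (N * Real.log (N * T)) := by
  have : NeZero N := ⟨hN.ne'⟩
  have hN0 : (0 : ℝ) < N := by exact_mod_cast hN
  have hT0 : (0 : ℝ) < T := by exact_mod_cast hT
  have hT1 : (1 : ℝ) ≤ T := by exact_mod_cast hT
  have hreg := isSeparableRegularizer_logBarrier hN hη
  have hΦ : IsPotential (logBarrierPotential N η) := hreg.isPotential
  obtain ⟨i, hi⟩ := exists_bestLoss_eq ℓ
  -- The barrier is infinite at a vertex, so the comparator is mixed with the uniform vector with
  -- weight 1/T. This costs at most one unit of loss and keeps each coordinate at least 1/(NT).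
  set u : Fin N → ℝ := fun j => (1 - 1 / (T : ℝ)) * (Pi.single i (1 : ℝ) : Fin N → ℝ) j
    + 1 / (N * T) with hu_def
  have hmem : Pi.single i (1 : ℝ) ∈ stdSimplex ℝ (Fin N) := single_mem_stdSimplex ℝ i
  have hT2 : 0 ≤ 1 - 1 / (T : ℝ) := by
    rw [sub_nonneg, div_le_one hT0]; exact hT1
  have hu1 : ∀ j, 1 / ((N : ℝ) * T) ≤ u j := fun j =>
    le_add_of_nonneg_left (mul_nonneg hT2 (hmem.1 j))
  have hu0 : ∀ j, 0 < u j := fun j => lt_of_lt_of_le (by positivity) (hu1 j)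
  have huS : u ∈ openSimplex N := by
    refine ⟨⟨fun j => (hu0 j).le, ?_⟩, hu0⟩
    simp only [hu_def, Finset.sum_add_distrib, ← Finset.mul_sum, hmem.2, Finset.sum_const,
      Finset.card_univ, Fintype.card_fin, nsmul_eq_mul]
    field_simp
    ring
  have hF : logBarrier η u ≤ η * (N * Real.log (N * T)) := by
    rw [logBarrier, neg_mul, ← mul_neg, ← Finset.sum_neg_distrib]
    refine mul_le_mul_of_nonneg_left ?_ hη.le
    calc ∑ j, -Real.log (u j) ≤ ∑ _j : Fin N, Real.log (N * T) := by
          refine Finset.sum_le_sum fun j _ => ?_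
          have := Real.log_le_log (by positivity) (hu1 j)
          rw [one_div, Real.log_inv] at this
          linarith
      _ = _ := by rw [Finset.sum_const, Finset.card_univ, Fintype.card_fin, nsmul_eq_mul]
  have hzero : 0 ≤ logBarrierPotential N η 0 := by
    obtain ⟨p, hp, hmin⟩ := hreg.minAttained 0
    rw [logBarrierPotential, IsSeparableRegularizer.potential_eq hp hmin, ftrlObjective]
    simpa using logBarrier_nonneg hη.le hp.1
  have hmain := expectedLoss_le_of_comparator hΦ (κ := 1 - 1 / (2 * η)) (c := 0)
    (K := η * (N * Real.log (N * T))) (u := u) (fun j => (hu0 j).le)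
    (fun L x hx => by
      refine (sum_grad_mul_le hΦ hx _ fun j s hs _ => hreg.le_potential_add_single L j hs).trans ?_
      refine Finset.sum_nonpos fun j _ => ?_
      have hp := hreg.grad_pos L j
      change 0 < grad (logBarrierPotential N η) L j at hp
      rw [if_pos hp]
      change 1 / (η / grad (logBarrierPotential N η) L j ^ 2) * x j ^ 2
        / (2 * grad (logBarrierPotential N η) L j) - _ ≤ 0
      set p := grad (logBarrierPotential N η) L j
      -- Since x² ≤ x, the second order cost p x²/(2η) is at most the part p x/(2η) of the loss
      -- given up through κ, so c = 0.
      have hx2 : x j ^ 2 ≤ x j := by have := hx j; nlinarith [this.1, this.2]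
      have e : 1 / (η / p ^ 2) * x j ^ 2 / (2 * p) - (1 - (1 - 1 / (2 * η))) * (p * x j)
          = p / (2 * η) * (x j ^ 2 - x j) := by field_simp; ring
      rw [e]
      exact mul_nonpos_of_nonneg_of_nonpos (by positivity) (by linarith))
    (fun L => by
      have := hreg.potential_le L huS
      rw [ftrlObjective] at this
      exact this.trans (by gcongr)) ℓ hℓ
  have hL0 : ∀ j, 0 ≤ ∑ t, ℓ t j := fun j => Finset.sum_nonneg fun t _ => (hℓ t j).1
  have hLT : ∀ j, ∑ t, ℓ t j ≤ T := fun j => by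
    calc ∑ t, ℓ t j ≤ ∑ _t : Fin T, (1 : ℝ) := Finset.sum_le_sum fun t _ => (hℓ t j).2
      _ = T := by simp
  have hsum : ∑ j, u j * ∑ t, ℓ t j ≤ bestLoss ℓ + 1 := by
    have e : ∑ j, u j * ∑ t, ℓ t j
        = (1 - 1 / (T : ℝ)) * ∑ t, ℓ t i + 1 / (N * T) * ∑ j, ∑ t, ℓ t j := by
      simp only [hu_def, add_mul, Finset.sum_add_distrib, ← Finset.mul_sum, mul_assoc]
      simp [Pi.single_apply]
    have h2 : ∑ j, ∑ t, ℓ t j ≤ N * T := by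
      calc ∑ j, ∑ t, ℓ t j ≤ ∑ _j : Fin N, (T : ℝ) := Finset.sum_le_sum fun j _ => hLT j
        _ = _ := by simp
    have h3 : 1 / ((N : ℝ) * T) * ∑ j, ∑ t, ℓ t j ≤ 1 := by
      rw [one_div_mul_eq_div, div_le_one (by positivity)]
      exact h2
    have h4 : 0 ≤ 1 / (T : ℝ) * ∑ t, ℓ t i := mul_nonneg (by positivity) (hL0 i)
    rw [e, hi]
    linarith
  linarith

lemma logBarrier_regret_le {N T : ℕ} (hN : 0 < N) (ℓ : Fin T → Fin N → ℝ) (hℓ : UnitLosses ℓ)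
    {η : ℝ} (hη : η = max 1 (Real.sqrt (N * bestLoss ℓ * Real.log (N * T)) /
      (N * Real.log (N * T)))) :
    expectedRegret (logBarrierPotential N η) ℓ
      ≤ 4 * (Real.sqrt (N * bestLoss ℓ * Real.log (N * T)) + N * Real.log (N * T)) := by
  have hη1 : 1 ≤ η := hη ▸ le_max_left _ _
  have hη0 : 0 < η := by linarith
  have hlog0 : 0 ≤ Real.log ((N : ℝ) * T) := by
    exact_mod_cast Real.log_natCast_nonneg (N * T)
  -- Outside these trivial cases NT ≥ 2, so the logarithm is bounded away from 0 and the additive 1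
  -- is absorbed by N log(NT).
  by_cases h : N = 1 ∨ T = 0
  · rw [expectedRegret_eq_zero (Φ := logBarrierPotential N η)
      (isSeparableRegularizer_logBarrier hN hη0).isPotential hN h]
    positivity
  rw [not_or] at h
  have : NeZero N := ⟨hN.ne'⟩
  have hN0 : (0 : ℝ) < N := by exact_mod_cast hN
  have hN2 : (2 : ℝ) ≤ N := by exact_mod_cast (show 2 ≤ N by omega)
  have hT : 0 < T := Nat.pos_of_ne_zero h.2
  have hT1 : (1 : ℝ) ≤ T := by exact_mod_cast hT
  have hlog : 1 / 2 ≤ Real.log ((N : ℝ) * T) := by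
    have := Real.log_le_log two_pos (show (2 : ℝ) ≤ N * T by nlinarith)
    linarith [Real.log_two_gt_d9]
  have hB : 0 ≤ bestLoss ℓ := by
    obtain ⟨i, hi⟩ := exists_bestLoss_eq ℓ
    rw [hi]
    exact Finset.sum_nonneg fun t _ => (hℓ t i).1
  have hmain := logBarrier_expectedLoss_le hN hT hη0 ℓ hℓ
  rw [expectedRegret]
  set E := expectedLoss (logBarrierPotential N η) ℓ
  set B := bestLoss ℓ
  set l := Real.log ((N : ℝ) * T)
  set S := Real.sqrt (N * B * l) with hS
  have hS0 : 0 ≤ S := Real.sqrt_nonneg _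
  have hSS : S * S = N * B * l := Real.mul_self_sqrt (by positivity)
  have hNl : 1 ≤ N * l := by nlinarith
  have hw : S / (N * l) ≤ η := hη ▸ le_max_right _ _
  -- The quotient in η balances B/η against η N log(NT); the maximum with 1 ensures 1 - 1/(2η) ≥
  -- 1/2, so that factor can be divided out at the end.
  have h1 : η * (N * l) ≤ N * l + S := by
    rw [hη, max_mul_of_nonneg _ _ (by positivity), one_mul, div_mul_cancel₀ _ (by positivity)]
    exact max_le (by linarith) (by linarith)
  have h2 : B / η ≤ S := by
    rw [div_le_iff₀ hη0]
    have : B = S * (S / (N * l)) := by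
      rw [mul_div_assoc', hSS]; field_simp
    rw [this]
    gcongr
  have h3 : (1 - 1 / (2 * η)) * (E - B) ≤ B / η / 2 + 1 + η * (N * l) := by
    have : (1 - 1 / (2 * η)) * B = B - B / η / 2 := by field_simp
    rw [mul_sub, this]
    linarith
  have h4 : 1 / 2 ≤ 1 - 1 / (2 * η) := by
    have : 1 / (2 * η) ≤ 1 / 2 := by
      gcongr; linarith
    linarith
  rcases le_total (E - B) 0 with hneg | hpos
  · have : 0 ≤ S + N * l := by positivity
    linarith
  · nlinarith [mul_le_mul_of_nonneg_right h4 hpos]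

end FTRLRegret

end Bandit

namespace Bandit

/-! ### FTPL: differentiability of the potential and the hazard rate argument -/

section FTPL

open Set Filter Topology

variable {N : ℕ} {D : Measure ℝ}

lemma ciInf_le_apply (x : Fin N → ℝ) (i : Fin N) : ⨅ j, x j ≤ x i :=
  ciInf_le (Set.finite_range x).bddBelow i

lemma lipschitzWith_ciInf [NeZero N] : LipschitzWith 1 fun x : Fin N → ℝ => ⨅ i, x i := by
  refine LipschitzWith.of_le_add fun x y => ?_
  rw [← sub_le_iff_le_add]
  refine le_ciInf fun i => ?_
  have h1 := ciInf_le_apply x i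
  have h2 : |x i - y i| ≤ dist x y := by rw [← Real.dist_eq]; exact dist_le_pi_dist x y i
  linarith [le_abs_self (x i - y i)]

lemma integrable_eval [IsProbabilityMeasure D] {f : ℝ → ℝ} (hf : Integrable f D) (i : Fin N) :
    Integrable (fun z : Fin N → ℝ => f (z i)) (Measure.pi fun _ : Fin N => D) :=
  (measurePreserving_eval (fun _ : Fin N => D) i).integrable_comp_of_integrable hf

lemma integral_eval [IsProbabilityMeasure D] {f : ℝ → ℝ} (hf : AEStronglyMeasurable f D)
    (i : Fin N) :
    ∫ z : Fin N → ℝ, f (z i) ∂(Measure.pi fun _ : Fin N => D) = ∫ x, f x ∂D := by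
  have h := measurePreserving_eval (fun _ : Fin N => D) i
  conv_rhs => rw [← h.map_eq]
  rw [integral_map h.measurable.aemeasurable (by rwa [h.map_eq])]

lemma integrable_ciInf_sub [NeZero N] [IsProbabilityMeasure D] (hD : Integrable (fun x => x) D)
    (L : Fin N → ℝ) :
    Integrable (fun z : Fin N → ℝ => ⨅ i, (L i - z i)) (Measure.pi fun _ : Fin N => D) := by
  have hint : Integrable (fun z : Fin N → ℝ => ∑ i, |L i - z i|)
      (Measure.pi fun _ : Fin N => D) :=
    integrable_finsetSum _ fun i _ => ((integrable_const (L i)).sub (integrable_eval hD i)).abs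
  refine hint.mono' ?_ (Eventually.of_forall fun z => ?_)
  · exact (lipschitzWith_ciInf.continuous.comp
      (continuous_const.sub continuous_id : Continuous fun z : Fin N → ℝ =>
        L - z)).aestronglyMeasurable
  · obtain ⟨i, hi⟩ := exists_eq_ciInf_of_finite (f := fun i => L i - z i)
    rw [← hi, Real.norm_eq_abs]
    exact Finset.single_le_sum (f := fun i => |L i - z i|) (fun j _ => abs_nonneg _)
      (Finset.mem_univ i)

/-- The perturbations for which action `i` is the unique perturbed leader. -/
def leaderSet (L : Fin N → ℝ) (i : Fin N) : Set (Fin N → ℝ) :=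
  {z | ∀ j, j ≠ i → L i - z i < L j - z j}

lemma isOpen_leaderSet (L : Fin N → ℝ) (i : Fin N) : IsOpen (leaderSet L i) := by
  simp only [leaderSet, ofPred_forall]
  exact isOpen_iInter_of_finite fun j => isOpen_iInter_of_finite fun _ =>
    isOpen_lt (by fun_prop) (by fun_prop)

lemma measurableSet_leaderSet (L : Fin N → ℝ) (i : Fin N) : MeasurableSet (leaderSet L i) :=
  (isOpen_leaderSet L i).measurableSet

lemma eq_of_mem_leaderSet {L z : Fin N → ℝ} {i j : Fin N} (hi : z ∈ leaderSet L i)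
    (hj : z ∈ leaderSet L j) : i = j := by
  by_contra h
  exact lt_asymm (hi j (Ne.symm h)) (hj i h)

lemma ciInf_eq_of_mem_leaderSet {L z : Fin N → ℝ} {i : Fin N} (hi : z ∈ leaderSet L i) :
    ⨅ j, (L j - z j) = L i - z i := by
  have : Nonempty (Fin N) := ⟨i⟩
  refine le_antisymm (ciInf_le_apply (fun j => L j - z j) i) (le_ciInf fun j => ?_)
  rcases eq_or_ne j i with rfl | h
  · exact le_rfl
  · exact (hi j h).le

/-- By Fubini: once the other coordinates are fixed, a tie forces zᵢ to be a single point. -/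
lemma pi_tie_eq_zero [IsProbabilityMeasure D] [NullSingletonClass D] {i j : Fin N} (hij : j ≠ i) (c : ℝ) :
    (Measure.pi fun _ : Fin N => D) {z | z i = z j + c} = 0 := by
  obtain ⟨n, rfl⟩ : ∃ n, N = n + 1 := ⟨N - 1, by have := i.pos; omega⟩
  obtain ⟨k, rfl⟩ := Fin.exists_succAbove_eq hij
  have h := measurePreserving_piFinSuccAbove (fun _ : Fin (n + 1) => D) i
  have hm : MeasurableSet {w : ℝ × (Fin n → ℝ) | w.1 = w.2 k + c} :=
    (isClosed_eq (by fun_prop) (by fun_prop)).measurableSet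
  have e : {z : Fin (n + 1) → ℝ | z i = z (i.succAbove k) + c}
      = MeasurableEquiv.piFinSuccAbove (fun _ => ℝ) i ⁻¹' {w | w.1 = w.2 k + c} := by
    ext z; rfl
  rw [e, h.measure_preimage hm.nullMeasurableSet, Measure.prod_apply_symm hm]
  refine (lintegral_congr fun y => ?_).trans lintegral_zero
  have : (fun x => (x, y)) ⁻¹' {w : ℝ × (Fin n → ℝ) | w.1 = w.2 k + c} = {y k + c} := by
    ext x; simp
  rw [this, measure_singleton]

lemma ae_exists_mem_leaderSet [NeZero N] [IsProbabilityMeasure D] [NullSingletonClass D] (L : Fin N → ℝ) :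
    ∀ᵐ z ∂(Measure.pi fun _ : Fin N => D), ∃ i, z ∈ leaderSet L i := by
  have h : ∀ i j : Fin N, j ≠ i →
      ∀ᵐ z ∂(Measure.pi fun _ : Fin N => D), L i - z i ≠ L j - z j := by
    intro i j hij
    have h0 := pi_tie_eq_zero (D := D) hij (L i - L j)
    refine measure_mono_null (fun z hz => ?_) h0
    simp only [ne_eq, compl_ofPred, not_not, mem_ofPred_eq] at hz ⊢
    linarith
  have h' : ∀ᵐ z ∂(Measure.pi fun _ : Fin N => D), ∀ i j : Fin N, j ≠ i →
      L i - z i ≠ L j - z j := by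
    rw [ae_all_iff]; intro i
    rw [ae_all_iff]; intro j
    by_cases hij : j = i
    · simp [hij]
    · filter_upwards [h i j hij] with z hz _ using hz
  filter_upwards [h'] with z hz
  obtain ⟨i, hi⟩ := Finite.exists_min fun i => L i - z i
  exact ⟨i, fun j hj => lt_of_le_of_ne (hi j) (hz i j hj)⟩

/-- Differentiation under the integral: the minimum is 1-Lipschitz in L, and almost surely there is
a unique leader i, which stays the leader near L, so the integrand has derivative `proj i`. -/
lemma hasFDerivAt_ftplPotential [NeZero N] [IsProbabilityMeasure D] [NullSingletonClass D]
    (hD : Integrable (fun x => x) D) (L : Fin N → ℝ) :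
    HasFDerivAt (ftplPotential N D)
      (∑ i, (Measure.pi fun _ : Fin N => D).real (leaderSet L i) •
        (ContinuousLinearMap.proj i : (Fin N → ℝ) →L[ℝ] ℝ)) L := by
  have hmeas : ∀ i : Fin N, AEStronglyMeasurable ((leaderSet L i).indicator fun _ =>
      (ContinuousLinearMap.proj i : (Fin N → ℝ) →L[ℝ] ℝ)) (Measure.pi fun _ : Fin N => D) :=
    fun i => aestronglyMeasurable_const.indicator (measurableSet_leaderSet L i)
  have h := hasFDerivAt_integral_of_dominated_loc_of_lip (𝕜 := ℝ)
    (μ := Measure.pi fun _ : Fin N => D)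
    (F := fun (L : Fin N → ℝ) z => ⨅ i, (L i - z i)) (x₀ := L) (s := univ) (bound := fun _ => 1)
    (F' := fun z => ∑ i, (leaderSet L i).indicator
      (fun _ => (ContinuousLinearMap.proj i : (Fin N → ℝ) →L[ℝ] ℝ)) z)
    univ_mem (Eventually.of_forall fun L' => (integrable_ciInf_sub hD L').aestronglyMeasurable)
    (integrable_ciInf_sub hD L)
    (Finset.aestronglyMeasurable_fun_sum _ fun i _ => hmeas i)
    (Eventually.of_forall fun z => by
      refine LipschitzWith.lipschitzOnWith ?_
      have := (lipschitzWith_ciInf (N := N)).comp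
        (LipschitzWith.id.sub (LipschitzWith.const z) : LipschitzWith _ fun x : Fin N → ℝ => x - z)
      simpa using! this)
    (integrable_const _)
    (by
      filter_upwards [ae_exists_mem_leaderSet (D := D) L] with z hz
      obtain ⟨i, hi⟩ := hz
      have e : ∑ j, (leaderSet L j).indicator
          (fun _ => (ContinuousLinearMap.proj j : (Fin N → ℝ) →L[ℝ] ℝ)) z
          = ContinuousLinearMap.proj i := by
        rw [Finset.sum_eq_single i, indicator_of_mem hi]
        · intro j _ hj
          exact indicator_of_notMem (fun hj' => hj (eq_of_mem_leaderSet hj' hi)) _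
        · simp
      rw [e]
      have hev : ∀ᶠ L' in 𝓝 L, z ∈ leaderSet L' i := by
        have : IsOpen {L' : Fin N → ℝ | ∀ j, j ≠ i → L' i - z i < L' j - z j} := by
          simp only [ofPred_forall]
          exact isOpen_iInter_of_finite fun j => isOpen_iInter_of_finite fun _ =>
            isOpen_lt (by fun_prop) (by fun_prop)
        exact this.mem_nhds hi
      refine HasFDerivAt.congr_of_eventuallyEq ?_
        (hev.mono fun L' hL' => ciInf_eq_of_mem_leaderSet hL')
      exact (ContinuousLinearMap.proj (R := ℝ) (φ := fun _ : Fin N => ℝ) i).hasFDerivAt.sub_const _)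
  convert! h.2 using 1
  rw [integral_finsetSum _ fun i _ =>
    (integrable_const _).indicator (measurableSet_leaderSet L i)]
  refine Finset.sum_congr rfl fun i _ => ?_
  rw [integral_indicator_const _ (measurableSet_leaderSet L i)]

lemma grad_ftplPotential [NeZero N] [IsProbabilityMeasure D] [NullSingletonClass D]
    (hD : Integrable (fun x => x) D) (L : Fin N → ℝ) (i : Fin N) :
    grad (ftplPotential N D) L i = (Measure.pi fun _ : Fin N => D).real (leaderSet L i) := by
  rw [grad, (hasFDerivAt_ftplPotential hD L).fderiv]
  simp [Pi.single_apply]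

lemma sum_real_leaderSet [NeZero N] [IsProbabilityMeasure D] [NullSingletonClass D] (L : Fin N → ℝ) :
    ∑ i, (Measure.pi fun _ : Fin N => D).real (leaderSet L i) = 1 := by
  rw [← measureReal_biUnion_finset
    (fun i _ j _ hij => Set.disjoint_left.2 fun z hi hj => hij (eq_of_mem_leaderSet hi hj))
    fun i _ => measurableSet_leaderSet L i]
  have : (⋃ i ∈ (Finset.univ : Finset (Fin N)), leaderSet L i)
      =ᵐ[Measure.pi fun _ : Fin N => D] univ := by
    rw [eventuallyEq_univ]
    filter_upwards [ae_exists_mem_leaderSet (D := D) L] with z hz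
    simpa using hz
  rw [measureReal_congr this]
  simp

lemma isPotential_ftplPotential [NeZero N] [IsProbabilityMeasure D] [NullSingletonClass D]
    (hD : Integrable (fun x => x) D) : IsPotential (ftplPotential N D) where
  concave := by
    refine ⟨convex_univ, fun x _ y _ a b ha hb hab => ?_⟩
    have hx := (integrable_ciInf_sub hD x).const_mul a
    have hy := (integrable_ciInf_sub hD y).const_mul b
    simp only [ftplPotential, smul_eq_mul]
    rw [← integral_const_mul, ← integral_const_mul, ← integral_add hx hy]
    refine integral_mono (hx.add hy) (integrable_ciInf_sub hD _) fun z => ?_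
    refine le_ciInf fun i => ?_
    have h1 := mul_le_mul_of_nonneg_left (ciInf_le_apply (fun j => x j - z j) i) ha
    have h2 := mul_le_mul_of_nonneg_left (ciInf_le_apply (fun j => y j - z j) i) hb
    have h3 : (a • x + b • y) i - z i = a * (x i - z i) + b * (y i - z i) := by
      simp only [Pi.add_apply, Pi.smul_apply, smul_eq_mul]
      linear_combination (z i) * hab
    rw [h3]
    exact add_le_add h1 h2
  differentiable := fun L => (hasFDerivAt_ftplPotential hD L).differentiableAt
  grad_mem := fun L =>
    ⟨fun i => by rw [grad_ftplPotential hD]; exact measureReal_nonneg, by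
      simp only [grad_ftplPotential hD]; exact sum_real_leaderSet L⟩

/-- The hazard rate of `D` is at most `h`: an integrated form, which needs no density. -/
def HazardLE (D : Measure ℝ) (h : ℝ) : Prop :=
  ∀ y s : ℝ, 0 ≤ s → D (Ioc y (y + s)) ≤ ENNReal.ofReal (h * s) * D (Ioi y)

/-- An atom at x lies in (x - s, x], whose mass is at most hs for every s > 0. -/
lemma HazardLE.noAtoms [IsProbabilityMeasure D] {h : ℝ} (hD : HazardLE D h) : NullSingletonClass D := by
  refine ⟨fun x => ?_⟩
  have h1 : ∀ s : ℝ, 0 < s → D {x} ≤ ENNReal.ofReal (h * s) := by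
    intro s hs
    have h2 := hD (x - s) s hs.le
    calc D {x} ≤ D (Ioc (x - s) (x - s + s)) :=
          measure_mono (by rintro _ rfl; exact ⟨by linarith, by simp⟩)
      _ ≤ _ := h2
      _ ≤ ENNReal.ofReal (h * s) * 1 := by gcongr; exact prob_le_one
      _ = _ := mul_one _
  have h3 : Tendsto (fun s : ℝ => ENNReal.ofReal (h * s)) (𝓝[>] 0) (𝓝 (ENNReal.ofReal (h * 0))) :=
    tendsto_nhdsWithin_of_tendsto_nhds
      ((ENNReal.continuous_ofReal.comp (continuous_const.mul continuous_id)).tendsto 0)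
  have h4 := ge_of_tendsto h3 (eventually_nhdsWithin_of_forall fun s hs => h1 s hs)
  simpa using h4

/-- Fix the other perturbations: if there are any, arm i leads exactly when zᵢ exceeds a threshold,
and raising Lᵢ by s shifts this threshold by s. The hazard bound says which fraction of the tail is
lost; integrate over the rest. -/
lemma HazardLE.real_leaderSet_le [IsProbabilityMeasure D] {h : ℝ} (hh : 0 ≤ h) (hD : HazardLE D h)
    (L : Fin N → ℝ) (i : Fin N) {s : ℝ} (hs : 0 ≤ s) :
    (Measure.pi fun _ : Fin N => D).real (leaderSet L i) ≤
      (Measure.pi fun _ : Fin N => D).real (leaderSet (L + Pi.single i s) i) +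
        h * s * (Measure.pi fun _ : Fin N => D).real (leaderSet L i) := by
  obtain ⟨n, rfl⟩ : ∃ n, N = n + 1 := ⟨N - 1, by have := i.pos; omega⟩
  have hmp := measurePreserving_piFinSuccAbove (fun _ : Fin (n + 1) => D) i
  set B : ℝ → Set (ℝ × (Fin n → ℝ)) := fun s =>
    {w | ∀ k, L i - L (i.succAbove k) + w.2 k + s < w.1} with hB
  have hBm : ∀ s, MeasurableSet (B s) := by
    intro s
    simp only [hB, ofPred_forall]
    exact (isOpen_iInter_of_finite fun j =>
      isOpen_lt (by fun_prop) (by fun_prop)).measurableSet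
  have hpre : ∀ s, leaderSet (L + Pi.single i s) i
      = MeasurableEquiv.piFinSuccAbove (fun _ => ℝ) i ⁻¹' B s := by
    intro s
    ext z
    change (∀ j, j ≠ i → (L + Pi.single i s : Fin (n + 1) → ℝ) i - z i <
      (L + Pi.single i s : Fin (n + 1) → ℝ) j - z j) ↔
      ∀ k, L i - L (i.succAbove k) + z (i.succAbove k) + s < z i
    constructor
    · intro hz k
      have := hz _ (Fin.succAbove_ne i k)
      simp only [Pi.add_apply, Pi.single_eq_same, Pi.single_eq_of_ne (Fin.succAbove_ne i k)] at this
      linarith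
    · intro hz j hj
      obtain ⟨k, rfl⟩ := Fin.exists_succAbove_eq hj
      have := hz k
      simp only [Pi.add_apply, Pi.single_eq_same, Pi.single_eq_of_ne hj]
      linarith
  have hmeasure : ∀ s, (Measure.pi fun _ : Fin (n + 1) => D) (leaderSet (L + Pi.single i s) i)
      = ∫⁻ y, D ((fun x => (x, y)) ⁻¹' B s) ∂(Measure.pi fun _ : Fin n => D) := by
    intro s
    rw [hpre, hmp.measure_preimage (hBm s).nullMeasurableSet, Measure.prod_apply_symm (hBm s)]
  have hsec : ∀ y : Fin n → ℝ, D ((fun x => (x, y)) ⁻¹' B 0)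
      ≤ D ((fun x => (x, y)) ⁻¹' B s) + ENNReal.ofReal (h * s) * D ((fun x => (x, y)) ⁻¹' B 0) := by
    intro y
    -- With a single arm there is no threshold and nothing is lost.
    rcases isEmpty_or_nonempty (Fin n) with hn | hn
    · have : ∀ s, (fun x => (x, y)) ⁻¹' B s = univ := fun s => by
        ext x; simp [hB]
      rw [this, this]
      exact le_self_add
    · obtain ⟨k₀, hk₀⟩ := Finite.exists_max fun k => L i - L (i.succAbove k) + y k
      have hIoi : ∀ s, (fun x => (x, y)) ⁻¹' B s
          = Ioi (L i - L (i.succAbove k₀) + y k₀ + s) := by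
        intro s
        ext x
        simp only [hB, mem_preimage, mem_ofPred_eq, mem_Ioi]
        exact ⟨fun hx => hx k₀, fun hx k => by have := hk₀ k; linarith⟩
      rw [hIoi, hIoi, add_zero]
      set c := L i - L (i.succAbove k₀) + y k₀
      rw [add_comm (D _)]
      calc D (Ioi c) = D (Ioc c (c + s) ∪ Ioi (c + s)) := by
            rw [Ioc_union_Ioi_eq_Ioi (by linarith)]
        _ ≤ D (Ioc c (c + s)) + D (Ioi (c + s)) := measure_union_le _ _
        _ ≤ _ := by gcongr; exact hD c s hs
  have key : (Measure.pi fun _ : Fin (n + 1) => D) (leaderSet L i)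
      ≤ (Measure.pi fun _ : Fin (n + 1) => D) (leaderSet (L + Pi.single i s) i)
        + ENNReal.ofReal (h * s) * (Measure.pi fun _ : Fin (n + 1) => D) (leaderSet L i) := by
    have h0 := hmeasure 0
    rw [Pi.single_zero, add_zero] at h0
    rw [h0, hmeasure s, ← lintegral_const_mul _ (measurable_measure_prodMk_right (hBm 0)),
      ← lintegral_add_left (measurable_measure_prodMk_right (hBm s))]
    exact lintegral_mono hsec
  have hfin := ENNReal.toReal_mono
    (ENNReal.add_ne_top.2 ⟨measure_ne_top _ _, ENNReal.mul_ne_top ENNReal.ofReal_ne_top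
      (measure_ne_top _ _)⟩) key
  rwa [ENNReal.toReal_add (measure_ne_top _ _) (ENNReal.mul_ne_top ENNReal.ofReal_ne_top
      (measure_ne_top _ _)), ENNReal.toReal_mul, ENNReal.toReal_ofReal (mul_nonneg hh hs)] at hfin

/-- Integrates `HazardLE.real_leaderSet_le` along the i-th axis: the partial derivative at distance
x is at least p - hpx. -/
lemma HazardLE.le_ftplPotential_add_single [NeZero N] [IsProbabilityMeasure D] {h : ℝ} (hh : 0 ≤ h)
    (hD : HazardLE D h) (hint : Integrable (fun x => x) D) (L : Fin N → ℝ) (i : Fin N) {s : ℝ}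
    (hs : 0 ≤ s) :
    ftplPotential N D L + grad (ftplPotential N D) L i * s
      - (h * grad (ftplPotential N D) L i) * s ^ 2 / 2 ≤ ftplPotential N D (L + Pi.single i s) := by
  have := hD.noAtoms
  set p := grad (ftplPotential N D) L i with hp
  have hder : ∀ x : ℝ, HasDerivAt
      (fun x => ftplPotential N D (L + Pi.single i x) - p * x + h * p * x ^ 2 / 2)
      (grad (ftplPotential N D) (L + Pi.single i x) i - p + h * p * x) x := by
    intro x
    have h1 : HasDerivAt (fun x : ℝ => L + Pi.single i x) (Pi.single i (1 : ℝ)) x := by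
      refine HasDerivAt.const_add _ ?_
      rw [hasDerivAt_pi]
      intro j
      rcases eq_or_ne j i with rfl | hj
      · simpa using! hasDerivAt_id x
      · simpa [hj] using! hasDerivAt_const x (0 : ℝ)
    have h2 := ((isPotential_ftplPotential hint).differentiable
      (L + Pi.single i x)).hasFDerivAt.comp_hasDerivAt x h1
    have h3 := ((h2.sub ((hasDerivAt_id x).const_mul p)).add
      ((((hasDerivAt_id x).pow 2).const_mul (h * p)).div_const 2))
    refine (h3.congr_deriv ?_)
    simp only [grad, id]
    push_cast
    ring
  have hmono := monotoneOn_of_deriv_nonneg (convex_Ici (0 : ℝ))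
    (fun x _ => (hder x).continuousAt.continuousWithinAt)
    (fun x _ => (hder x).differentiableAt.differentiableWithinAt)
    (fun x hx => by
      rw [interior_Ici] at hx
      rw [(hder x).deriv]
      have := hD.real_leaderSet_le hh L i (le_of_lt hx)
      rw [← grad_ftplPotential hint, ← grad_ftplPotential hint, ← hp] at this
      linarith)
  have := hmono (show (0 : ℝ) ∈ Ici 0 from self_mem_Ici) (show s ∈ Ici 0 from hs) hs
  simp only [Pi.single_zero, add_zero] at this
  nlinarith

lemma HazardLE.ftpl_regret_le {T : ℕ} (hN : 0 < N) [IsProbabilityMeasure D] {h : ℝ} (hh : 0 ≤ h)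
    (hD : HazardLE D h) (hint : Integrable (fun x => x) D) (a : ℝ)
    (ℓ : Fin T → Fin N → ℝ) (hℓ : UnitLosses ℓ) :
    expectedRegret (ftplPotential N D) ℓ
      ≤ a + N * ∫ x, max (x - a) 0 ∂D - ∫ x, x ∂D + N * T * h / 2 := by
  have : NeZero N := ⟨hN.ne'⟩
  have := hD.noAtoms
  have hΦ := isPotential_ftplPotential (N := N) hint
  obtain ⟨i, hi⟩ := exists_bestLoss_eq ℓ
  have hmax : Integrable (fun x => max (x - a) 0) D :=
    (hint.sub (integrable_const a)).sup (integrable_const 0)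
  -- Uses max zⱼ ≤ a + ∑ (zⱼ - a)⁺, which trades the maximum for one-dimensional excesses.
  have hzero : -(a + N * ∫ x, max (x - a) 0 ∂D) ≤ ftplPotential N D 0 := by
    have e : -(a + N * ∫ x, max (x - a) 0 ∂D)
        = ∫ z : Fin N → ℝ, -(a + ∑ j, max (z j - a) 0) ∂(Measure.pi fun _ : Fin N => D) := by
      rw [integral_neg, integral_add (integrable_const _)
        (integrable_finsetSum _ fun j _ => integrable_eval hmax j),
        integral_finsetSum _ fun j _ => integrable_eval hmax j]
      simp only [integral_eval hmax.aestronglyMeasurable]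
      simp
    rw [e]
    refine integral_mono ((integrable_const _).add
      (integrable_finsetSum _ fun j _ => integrable_eval hmax j)).neg
      (integrable_ciInf_sub hint 0) fun z => le_ciInf fun j => ?_
    have h1 := Finset.single_le_sum (f := fun j => max (z j - a) 0)
      (fun k _ => le_max_right _ _) (Finset.mem_univ j)
    have h2 : z j - a ≤ max (z j - a) 0 := le_max_left _ _
    simp only [Pi.zero_apply] at h1 ⊢
    linarith
  have hmem : Pi.single i (1 : ℝ) ∈ stdSimplex ℝ (Fin N) := single_mem_stdSimplex ℝ i
  have hmain := expectedLoss_le_of_comparator hΦ (κ := 1) (c := N * h / 2) (K := -∫ x, x ∂D)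
    (u := Pi.single i (1 : ℝ)) (fun j => hmem.1 j)
    (fun L x hx => by
      refine (sum_grad_mul_le hΦ hx 1 fun j s hs _ =>
        hD.le_ftplPotential_add_single hh hint L j hs).trans ?_
      have e : (N : ℝ) * h / 2 = ∑ _j : Fin N, h / 2 := by
        rw [Finset.sum_const, Finset.card_univ, Fintype.card_fin, nsmul_eq_mul]; ring
      rw [e]
      refine Finset.sum_le_sum fun j _ => ?_
      split_ifs with hp
      · have hx2 : x j ^ 2 ≤ 1 := by have := hx j; nlinarith [this.1, this.2]
        set p := grad (ftplPotential N D) L j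
        -- The factor p in bⱼ = hp cancels the 1/p of importance weighting, leaving at most h/2 per
        -- arm.
        have e2 : h * p * x j ^ 2 / (2 * p) - (1 - 1) * (p * x j) = h / 2 * x j ^ 2 := by
          field_simp; ring
        rw [e2]
        nlinarith
      · positivity)
    (fun L => by
      have h1 : ∫ z : Fin N → ℝ, (L i - z i) ∂(Measure.pi fun _ : Fin N => D)
          = L i + -∫ x, x ∂D := by
        rw [integral_sub (integrable_const _) (integrable_eval hint i),
          integral_eval hint.aestronglyMeasurable]
        simp [sub_eq_add_neg]
      have h2 : ftplPotential N D L ≤ L i + -∫ x, x ∂D := by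
        rw [← h1]
        exact integral_mono (integrable_ciInf_sub hint L)
          ((integrable_const _).sub (integrable_eval hint i))
          fun z => ciInf_le_apply (fun j => L j - z j) i
      simpa [Pi.single_apply] using h2) ℓ hℓ
  simp only [Pi.single_apply, ite_mul, one_mul, zero_mul, Finset.sum_ite_eq', Finset.mem_univ,
    if_true] at hmain
  rw [expectedRegret, hi]
  linarith

end FTPL

end Bandit

namespace Bandit

/-! ### Hazard rates and tails of the five families -/

section Tails

open Set Filter Topology

/-- On (y, y + s] the density at x is at most h times the tail beyond x, hence at most h times the
larger tail beyond y. -/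
lemma hazardLE_withDensity {f : ℝ → ℝ} {h : ℝ} (hh : 0 ≤ h)
    (hle : ∀ x, ENNReal.ofReal (f x) ≤
      ENNReal.ofReal h * volume.withDensity (fun x => ENNReal.ofReal (f x)) (Ioi x)) :
    HazardLE (volume.withDensity fun x => ENNReal.ofReal (f x)) h := by
  intro y s hs
  set D := volume.withDensity fun x => ENNReal.ofReal (f x)
  calc D (Ioc y (y + s)) = ∫⁻ x in Ioc y (y + s), ENNReal.ofReal (f x) :=
        withDensity_apply _ measurableSet_Ioc
    _ ≤ ∫⁻ _x in Ioc y (y + s), ENNReal.ofReal h * D (Ioi y) := by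
        refine setLIntegral_mono' measurableSet_Ioc fun x hx => (hle x).trans ?_
        gcongr
        exact hx.1.le
    _ = ENNReal.ofReal (h * s) * D (Ioi y) := by
        rw [setLIntegral_const, Real.volume_Ioc, add_sub_cancel_left, ENNReal.ofReal_mul hh]
        ring

lemma withDensity_Ioi {f G : ℝ → ℝ} {x l : ℝ} (hcont : ContinuousWithinAt G (Ici x) x)
    (hder : ∀ y ∈ Ioi x, HasDerivAt G (f y) y) (hf : ∀ y ∈ Ioi x, 0 ≤ f y)
    (hlim : Tendsto G atTop (𝓝 l)) :
    volume.withDensity (fun x => ENNReal.ofReal (f x)) (Ioi x) = ENNReal.ofReal (l - G x) := by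
  rw [withDensity_apply _ measurableSet_Ioi,
    ← integral_Ioi_of_hasDerivAt_of_nonneg hcont hder hf hlim]
  refine (ofReal_integral_eq_lintegral_ofReal
    (integrableOn_Ioi_deriv_of_nonneg hcont hder hf hlim) ?_).symm
  exact (ae_restrict_iff' measurableSet_Ioi).2 (Eventually.of_forall hf)

lemma measure_iUnion_Ioi_eq_one {D : Measure ℝ} {G : ℝ → ℝ} {u : ℕ → ℝ} (hu : Antitone u)
    (htail : ∀ n, D (Ioi (u n)) = ENNReal.ofReal (1 - G (u n)))
    (hlim : Tendsto (fun n => G (u n)) atTop (𝓝 0)) : D (⋃ n, Ioi (u n)) = 1 := by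
  refine tendsto_nhds_unique
    (tendsto_measure_iUnion_atTop fun m n hmn => Ioi_subset_Ioi (hu hmn)) ?_
  have h := (ENNReal.continuous_ofReal.tendsto (1 - 0)).comp (hlim.const_sub 1)
  rw [sub_zero, ENNReal.ofReal_one] at h
  exact h.congr fun n => (htail n).symm

/-- Layer-cake formula, with G an antiderivative of the tail bound S. -/
lemma lintegral_ofReal_sub_le {D : Measure ℝ} {a l : ℝ} {S G : ℝ → ℝ}
    (hS : ∀ t, 0 < t → D (Ioi (a + t)) ≤ ENNReal.ofReal (S t))
    (hG : ∀ t, 0 ≤ t → HasDerivAt G (S t) t) (hS0 : ∀ t, 0 < t → 0 ≤ S t)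
    (hlim : Tendsto G atTop (𝓝 l)) :
    ∫⁻ x, ENNReal.ofReal (x - a) ∂D ≤ ENNReal.ofReal (l - G 0) := by
  have h1 : ∫⁻ x, ENNReal.ofReal (x - a) ∂D = ∫⁻ x, ENNReal.ofReal (max (x - a) 0) ∂D :=
    lintegral_congr fun x => by rw [ENNReal.ofReal_max]; simp
  rw [h1, lintegral_eq_lintegral_meas_lt D (f := fun x => max (x - a) 0)
    (Eventually.of_forall fun x => le_max_right _ _) (by fun_prop)]
  calc ∫⁻ t in Ioi 0, D {x | t < max (x - a) 0} ≤ ∫⁻ t in Ioi 0, ENNReal.ofReal (S t) := by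
        refine setLIntegral_mono' measurableSet_Ioi fun t ht => ?_
        have : {x | t < max (x - a) 0} = Ioi (a + t) := by
          ext x
          simp only [mem_ofPred_eq, lt_max_iff, mem_Ioi, not_lt.2 (le_of_lt (mem_Ioi.1 ht)), or_false]
          constructor <;> intro h <;> linarith
        rw [this]
        exact hS t ht
    _ = volume.withDensity (fun t => ENNReal.ofReal (S t)) (Ioi 0) :=
        (withDensity_apply _ measurableSet_Ioi).symm
    _ = _ := withDensity_Ioi (hG 0 le_rfl).continuousAt.continuousWithinAt
        (fun t ht => hG t (le_of_lt ht)) hS0 hlim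

/-- A perturbation law with hazard rate at most `h`, with mean excess at most `K` over the level
`a`, and with negative part of mean at most `K'`. -/
structure IsPerturbation (D : Measure ℝ) (h a K K' : ℝ) : Prop where
  isProb : IsProbabilityMeasure D
  hazard : HazardLE D h
  excess : ∫⁻ x, ENNReal.ofReal (x - a) ∂D ≤ ENNReal.ofReal K
  negPart : ∫⁻ x, ENNReal.ofReal (-x) ∂D ≤ ENNReal.ofReal K'

lemma integrable_max_zero {D : Measure ℝ} {f : ℝ → ℝ} (hf : Measurable f) {K : ℝ}
    (hK : ∫⁻ x, ENNReal.ofReal (f x) ∂D ≤ ENNReal.ofReal K) :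
    Integrable (fun x => max (f x) 0) D := by
  refine ⟨(hf.max measurable_const).aestronglyMeasurable, ?_⟩
  rw [hasFiniteIntegral_iff_ofReal (f := fun x => max (f x) 0)
    (Eventually.of_forall fun x => le_max_right _ _)]
  have : ∀ x, ENNReal.ofReal (max (f x) 0) = ENNReal.ofReal (f x) := fun x => by
    rw [ENNReal.ofReal_max]; simp
  simp only [this]
  exact hK.trans_lt ENNReal.ofReal_lt_top

lemma integral_max_zero_le {D : Measure ℝ} {f : ℝ → ℝ} (hf : Measurable f) {K : ℝ} (hK0 : 0 ≤ K)
    (hK : ∫⁻ x, ENNReal.ofReal (f x) ∂D ≤ ENNReal.ofReal K) :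
    ∫ x, max (f x) 0 ∂D ≤ K := by
  rw [integral_eq_lintegral_of_nonneg_ae (f := fun x => max (f x) 0)
    (Eventually.of_forall fun x => le_max_right _ _) (hf.max measurable_const).aestronglyMeasurable]
  have : ∀ x, ENNReal.ofReal (max (f x) 0) = ENNReal.ofReal (f x) := fun x => by
    rw [ENNReal.ofReal_max]; simp
  simp only [this]
  exact ENNReal.toReal_le_of_le_ofReal hK0 hK

namespace IsPerturbation

variable {D : Measure ℝ} {h a K K' : ℝ}

lemma integrable (hD : IsPerturbation D h a K K') : Integrable (fun x => x) D := by
  have := hD.isProb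
  have h1 := integrable_max_zero (by fun_prop) hD.excess
  have h2 := integrable_max_zero (by fun_prop) hD.negPart
  refine ((h1.add (integrable_const |a|)).add h2).mono' (by fun_prop)
    (Eventually.of_forall fun x => ?_)
  rw [Real.norm_eq_abs, abs_le]
  simp only [Pi.add_apply]
  have h3 := le_max_left (x - a) 0
  have h4 := le_max_right (x - a) 0
  have h5 := le_max_left (-x) 0
  have h6 := le_max_right (-x) 0
  have h7 := abs_nonneg a
  have h8 := le_abs_self a
  constructor <;> linarith

lemma isPotential (hD : IsPerturbation D h a K K') {N : ℕ} (hN : 0 < N) :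
    IsPotential (ftplPotential N D) := by
  have := hD.isProb
  have : NeZero N := ⟨hN.ne'⟩
  have := hD.hazard.noAtoms
  exact isPotential_ftplPotential hD.integrable

lemma regret_le (hD : IsPerturbation D h a K K') {N T : ℕ} (hN : 0 < N) (hh : 0 ≤ h) (hK : 0 ≤ K)
    (hK' : 0 ≤ K') (ℓ : Fin T → Fin N → ℝ) (hℓ : UnitLosses ℓ) :
    expectedRegret (ftplPotential N D) ℓ ≤ a + N * K + K' + N * T * h / 2 := by
  have := hD.isProb
  refine (hD.hazard.ftpl_regret_le hN hh hD.integrable a ℓ hℓ).trans ?_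
  have h1 := integral_max_zero_le (by fun_prop) hK hD.excess
  have h2 := integral_max_zero_le (by fun_prop) hK' hD.negPart
  have h3 : ∫ x, -x ∂D ≤ ∫ x, max (-x) 0 ∂D :=
    integral_mono hD.integrable.neg (integrable_max_zero (by fun_prop) hD.negPart)
      fun x => le_max_left _ _
  rw [integral_neg] at h3
  have h4 : (N : ℝ) * ∫ x, max (x - a) 0 ∂D ≤ N * K := by gcongr
  linarith

end IsPerturbation

lemma lintegral_ofReal_neg_eq_zero {f : ℝ → ENNReal} (hf : ∀ x < 0, f x = 0) :
    ∫⁻ x, ENNReal.ofReal (-x) ∂(volume.withDensity f) = 0 := by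
  have h0 : (volume.withDensity f) (Iio 0) = 0 := by
    rw [withDensity_apply _ measurableSet_Iio]
    exact setLIntegral_eq_zero measurableSet_Iio fun x hx => hf x hx
  rw [lintegral_eq_zero_iff (by fun_prop)]
  refine measure_mono_null (fun x hx => ?_) h0
  by_contra hx'
  exact hx (ENNReal.ofReal_of_nonpos (by simpa using hx'))

lemma lintegral_excess_exp_le {D : Measure ℝ} {a b : ℝ} (hb : 0 < b)
    (hS : ∀ t, 0 < t → D (Ioi (a + t)) ≤ ENNReal.ofReal (Real.exp (-(a + t) / b))) :
    ∫⁻ x, ENNReal.ofReal (x - a) ∂D ≤ ENNReal.ofReal (b * Real.exp (-a / b)) := by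
  have h := lintegral_ofReal_sub_le (D := D) (a := a) (l := 0)
    (S := fun t => Real.exp (-(a + t) / b)) (G := fun t => -b * Real.exp (-(a + t) / b)) hS
    (fun t _ => by
      have h1 : HasDerivAt (fun t : ℝ => -(a + t) / b) (-1 / b) t :=
        (((hasDerivAt_id t).const_add a).neg).div_const b
      convert! h1.exp.const_mul (-b) using 1
      field_simp)
    (fun t _ => (Real.exp_pos _).le)
    (by
      have h1 : Tendsto (fun t : ℝ => -(a + t) / b) atTop atBot := by
        have h2 := tendsto_atTop_add_const_left atTop a tendsto_id
        exact (tendsto_neg_atTop_atBot.comp h2).atBot_div_const hb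
      simpa using (Real.tendsto_exp_atBot.comp h1).const_mul (-b))
  simpa using h

/-- The exponential law has constant hazard rate 1/b on its support. Its negative part vanishes; the
bound b is slack, kept to match the Gumbel law. -/
lemma isPerturbation_exponential {b : ℝ} (hb : 0 < b) {a : ℝ} (ha : 0 ≤ a) :
    IsPerturbation (volume.withDensity fun x => ENNReal.ofReal
      (if 0 < x then 1 / b * Real.exp (-x / b) else 0)) (1 / b) a (b * Real.exp (-a / b)) b := by
  have htail : ∀ x, 0 ≤ x → volume.withDensity (fun x => ENNReal.ofReal
      (if 0 < x then 1 / b * Real.exp (-x / b) else 0)) (Ioi x)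
        = ENNReal.ofReal (Real.exp (-x / b)) := by
    intro x hx
    have hder : ∀ y : ℝ, HasDerivAt (fun y : ℝ => -Real.exp (-y / b))
        (1 / b * Real.exp (-y / b)) y := by
      intro y
      have h1 : HasDerivAt (fun y : ℝ => -y / b) (-1 / b) y := (hasDerivAt_neg y).div_const b
      convert! h1.exp.neg using 1
      ring
    rw [withDensity_Ioi (G := fun y : ℝ => -Real.exp (-y / b)) (l := 0)
      (hder x).continuousAt.continuousWithinAt]
    · simp
    · intro y hy
      rw [if_pos (hx.trans_lt hy)]
      exact hder y
    · intro y hy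
      rw [if_pos (hx.trans_lt hy)]
      positivity
    · have h1 : Tendsto (fun t : ℝ => -t / b) atTop atBot :=
        tendsto_neg_atTop_atBot.atBot_div_const hb
      simpa using (Real.tendsto_exp_atBot.comp h1).neg
  refine ⟨⟨?_⟩, hazardLE_withDensity (by positivity) fun x => ?_, ?_, ?_⟩
  · rw [← compl_union_self (Ioi (0 : ℝ)),
      measure_union disjoint_compl_left measurableSet_Ioi, htail 0 le_rfl, compl_Ioi,
      withDensity_apply _ measurableSet_Iic,
      setLIntegral_eq_zero measurableSet_Iic fun x hx => by
        rw [if_neg (not_lt.2 hx), ENNReal.ofReal_zero]; rfl]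
    simp
  · split_ifs with hx
    · rw [htail x hx.le, ENNReal.ofReal_mul (by positivity)]
    · simp
  · exact lintegral_excess_exp_le hb fun t ht => (htail _ (by linarith)).le
  · rw [lintegral_ofReal_neg_eq_zero fun x hx => by rw [if_neg (not_lt.2 hx.le)]; simp]
    exact zero_le

/-- The two densities can differ at 0, so they are compared almost everywhere. -/
lemma gammaMeasure_one {b : ℝ} :
    gammaMeasure 1 (1 / b) = volume.withDensity fun x => ENNReal.ofReal
      (if 0 < x then 1 / b * Real.exp (-x / b) else 0) := by
  refine withDensity_congr_ae ?_
  have : ∀ᵐ x : ℝ, x ≠ 0 := by simp [ae_iff]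
  filter_upwards [this] with x hx
  rw [gammaPDF, gammaPDFReal]
  have e : (0 ≤ x) = (0 < x) := propext ⟨fun h => lt_of_le_of_ne h hx.symm, le_of_lt⟩
  simp only [e]
  congr 2
  simp
  left
  ring_nf

lemma weibullMeasure_one {b : ℝ} :
    weibullMeasure b 1 = volume.withDensity fun x => ENNReal.ofReal
      (if 0 < x then 1 / b * Real.exp (-x / b) else 0) := by
  unfold weibullMeasure
  congr with x
  simp [neg_div]

/-- With v = e^(-x/b), the hazard rate is v/(b(e^v - 1)) ≤ 1/b, and the tail 1 - e^(-v) is at most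
v, an exponential tail. -/
lemma isPerturbation_gumbel {b : ℝ} (hb : 0 < b) (a : ℝ) :
    IsPerturbation (gumbelMeasure 0 b) (1 / b) a (b * Real.exp (-a / b)) b := by
  set G : ℝ → ℝ := fun x => Real.exp (-Real.exp (-(x / b))) with hG
  have hlimT : Tendsto G atTop (𝓝 1) := by
    have h1 : Tendsto (fun t : ℝ => -(t / b)) atTop atBot :=
      tendsto_neg_atTop_atBot.comp (tendsto_id.atTop_div_const hb)
    have h2 := (Real.continuous_exp.tendsto _).comp (Real.tendsto_exp_atBot.comp h1).neg
    simpa using! h2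
  have hlimB : Tendsto G atBot (𝓝 0) := by
    have h1 : Tendsto (fun t : ℝ => -(t / b)) atBot atTop :=
      tendsto_neg_atBot_atTop.comp (tendsto_id.atBot_div_const hb)
    exact Real.tendsto_exp_atBot.comp
      (tendsto_neg_atTop_atBot.comp (Real.tendsto_exp_atTop.comp h1))
  have hder : ∀ y : ℝ, HasDerivAt G
      (1 / b * Real.exp (-((y - 0) / b) - Real.exp (-((y - 0) / b)))) y := by
    intro y
    have h1 : HasDerivAt (fun y : ℝ => -(y / b)) (-(1 / b)) y :=
      ((hasDerivAt_id y).div_const b).neg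
    convert! h1.exp.neg.exp using 1
    rw [sub_zero, sub_eq_add_neg, Real.exp_add]
    simp only [Pi.neg_apply]
    ring
  have htail : ∀ x, gumbelMeasure 0 b (Ioi x) = ENNReal.ofReal (1 - G x) := fun x =>
    withDensity_Ioi (hder x).continuousAt.continuousWithinAt (fun y _ => hder y)
      (fun y _ => by positivity) hlimT
  have hprob : IsProbabilityMeasure (gumbelMeasure 0 b) := by
    constructor
    have hU : ⋃ n : ℕ, Ioi (-(n : ℝ)) = univ := eq_univ_of_forall fun x => mem_iUnion.2 <| by
      obtain ⟨n, hn⟩ := exists_nat_gt (-x)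
      exact ⟨n, by rw [mem_Ioi]; linarith⟩
    rw [← hU]
    exact measure_iUnion_Ioi_eq_one (fun m n hmn => by simpa using hmn) (fun n => htail _)
      (hlimB.comp (tendsto_neg_atTop_atBot.comp tendsto_natCast_atTop_atTop))
  refine ⟨hprob, hazardLE_withDensity (by positivity) fun x => ?_, ?_, ?_⟩
  · change _ ≤ _ * gumbelMeasure 0 b (Ioi x)
    rw [htail, ← ENNReal.ofReal_mul (by positivity)]
    refine ENNReal.ofReal_le_ofReal (mul_le_mul_of_nonneg_left ?_ (by positivity))
    rw [sub_zero, hG, sub_eq_add_neg, Real.exp_add]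
    set v := Real.exp (-(x / b))
    have h1 : v + 1 ≤ Real.exp v := Real.add_one_le_exp v
    have h2 : Real.exp v * Real.exp (-v) = 1 := by rw [← Real.exp_add]; simp
    nlinarith [Real.exp_pos (-v)]
  · refine lintegral_excess_exp_le hb fun t _ => ?_
    rw [htail]
    refine ENNReal.ofReal_le_ofReal ?_
    have := Real.add_one_le_exp (-Real.exp (-((a + t) / b)))
    rw [neg_div]
    simp only [hG]
    linarith
  -- The reflected law has tail exp(-e^(t/b)) ≤ e^(-t/b), so the exponential excess bound applies at
  -- level 0.
  · have h1 : ∫⁻ x, ENNReal.ofReal (x - 0) ∂((gumbelMeasure 0 b).map Neg.neg)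
        ≤ ENNReal.ofReal (b * Real.exp (-0 / b)) := by
      refine lintegral_excess_exp_le hb fun t _ => ?_
      rw [Measure.map_apply measurable_neg measurableSet_Ioi, zero_add]
      calc gumbelMeasure 0 b (Neg.neg ⁻¹' Ioi t) ≤ gumbelMeasure 0 b (Ioi (-t))ᶜ := by
            refine measure_mono fun x hx => ?_
            simp only [mem_preimage, mem_Ioi, compl_Ioi, mem_Iic] at hx ⊢
            linarith
        _ = ENNReal.ofReal (G (-t)) := by
            have hG1 : G (-t) ≤ 1 := Real.exp_le_one_iff.2 (by
              have := Real.exp_pos (-(-t / b)); linarith)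
            rw [prob_compl_eq_one_sub measurableSet_Ioi, htail, ← ENNReal.ofReal_one,
              ← ENNReal.ofReal_sub _ (by linarith), sub_sub_cancel]
        _ ≤ _ := by
            refine ENNReal.ofReal_le_ofReal (Real.exp_le_exp.2 ?_)
            have := Real.add_one_le_exp (-(-t / b))
            rw [neg_div, neg_neg] at this
            simp only [neg_div, neg_neg]
            linarith
    rw [lintegral_map (by fun_prop) measurable_neg] at h1
    simpa using h1

lemma lintegral_excess_rpow_le {D : Measure ℝ} {a s α : ℝ} (ha : 0 < a) (hs : 0 < s) (hα : 1 < α)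
    (hS : ∀ t, 0 < t → D (Ioi (a + t)) ≤ ENNReal.ofReal (s ^ α * (a + t) ^ (-α))) :
    ∫⁻ x, ENNReal.ofReal (x - a) ∂D ≤ ENNReal.ofReal (s ^ α * a ^ (1 - α) / (α - 1)) := by
  have hα' : 0 < α - 1 := by linarith
  have h := lintegral_ofReal_sub_le (D := D) (a := a) (l := 0)
    (S := fun t => s ^ α * (a + t) ^ (-α))
    (G := fun t => -(s ^ α / (α - 1)) * (a + t) ^ (1 - α)) hS
    (fun t ht => by
      have h1 := ((hasDerivAt_id t).const_add a).rpow_const (p := 1 - α)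
        (Or.inl (show a + t ≠ 0 by linarith))
      convert! h1.const_mul (-(s ^ α / (α - 1))) using 1
      rw [show 1 - α - 1 = -α by ring]
      simp only [id]
      field_simp
      ring)
    (fun t ht => by positivity)
    (by
      have h2 := tendsto_atTop_add_const_left atTop a tendsto_id
      have h3 := (tendsto_rpow_neg_atTop hα').comp h2
      rw [neg_sub] at h3
      simpa using! h3.const_mul (-(s ^ α / (α - 1))))
  refine h.trans_eq ?_
  congr 1
  rw [add_zero]
  ring

/-- The hazard rate is α/x ≤ α/s on the support; the extra factor 2 serves to share the form of the
Fréchet bound. -/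
lemma isPerturbation_pareto {s α : ℝ} (hs : 0 < s) (hα : 1 < α) {a : ℝ} (ha : s ≤ a) :
    IsPerturbation (paretoMeasure s α) (2 * α / s) a (s ^ α * a ^ (1 - α) / (α - 1)) 0 := by
  have hα0 : 0 < α := by linarith
  have hder : ∀ y, s ≤ y → HasDerivAt (fun y : ℝ => -(s ^ α * y ^ (-α)))
      (α * s ^ α * y ^ (-(α + 1))) y := by
    intro y hy
    have h1 := (Real.hasDerivAt_rpow_const (p := -α)
      (Or.inl (show y ≠ 0 by linarith))).const_mul (s ^ α)
    convert! h1.neg using 1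
    rw [show -α - 1 = -(α + 1) by ring]
    ring
  have htail : ∀ x, s ≤ x → paretoMeasure s α (Ioi x) = ENNReal.ofReal (s ^ α * x ^ (-α)) := by
    intro x hx
    have h := withDensity_Ioi (f := paretoPDFReal s α) (G := fun y : ℝ => -(s ^ α * y ^ (-α)))
      (l := 0) (x := x) (hder x hx).continuousAt.continuousWithinAt
      (fun y hy => by
        rw [paretoPDFReal, if_pos (hx.trans (le_of_lt hy))]
        exact hder y (hx.trans (le_of_lt hy)))
      (fun y _ => paretoPDFReal_nonneg hs.le hα0.le y)
      (by simpa using ((tendsto_rpow_neg_atTop hα0).const_mul (s ^ α)).neg)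
    rw [zero_sub, neg_neg] at h
    exact h
  refine ⟨isProbabilityMeasure_paretoMeasure hs hα0,
    hazardLE_withDensity (f := paretoPDFReal s α) (by positivity) fun x => ?_, ?_, ?_⟩
  · change _ ≤ _ * paretoMeasure s α (Ioi x)
    rw [paretoPDFReal]
    split_ifs with hx
    · have hx0 : 0 < x := hs.trans_le hx
      rw [htail x hx, ← ENNReal.ofReal_mul (by positivity)]
      refine ENNReal.ofReal_le_ofReal ?_
      have e : x ^ (-(α + 1)) = x ^ (-α) / x := by
        rw [← Real.rpow_sub_one hx0.ne']; ring_nf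
      rw [e]
      calc α * s ^ α * (x ^ (-α) / x) = α / x * (s ^ α * x ^ (-α)) := by ring
        _ ≤ 2 * α / s * (s ^ α * x ^ (-α)) := by
          gcongr
          linarith
    · simp
  · exact lintegral_excess_rpow_le (hs.trans_le ha) hs hα fun t ht => (htail _ (by linarith)).le
  · refine (lintegral_ofReal_neg_eq_zero fun x hx => ?_).le.trans zero_le
    exact paretoPDF_of_lt (hx.trans hs)

/-- With u = x/s and v = u^(-α), the hazard rate is (α/s) u⁻¹ v/(e^v - 1). Here u⁻¹ ≤ 1 + v: it is
at most 1 for u ≥ 1 and at most v for u ≤ 1, as α > 1. Then v(1 + v) ≤ 2(e^v - 1) gives the factor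
2. The tail 1 - e^(-v) ≤ v is of Pareto type. -/
lemma isPerturbation_frechet {s α : ℝ} (hs : 0 < s) (hα : 1 < α) {a : ℝ} (ha : s ≤ a) :
    IsPerturbation (frechetMeasure α s) (2 * α / s) a (s ^ α * a ^ (1 - α) / (α - 1)) 0 := by
  have hα0 : 0 < α := by linarith
  set G : ℝ → ℝ := fun x => Real.exp (-(x / s) ^ (-α)) with hG
  have hlimT : Tendsto G atTop (𝓝 1) := by
    have h1 := (tendsto_rpow_neg_atTop hα0).comp (tendsto_id.atTop_div_const hs)
    have h2 := (Real.continuous_exp.tendsto _).comp h1.neg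
    simpa using! h2
  have hlim0 : Tendsto G (𝓝[>] 0) (𝓝 0) := by
    have h1 : Tendsto (fun x : ℝ => x / s) (𝓝[>] 0) (𝓝[>] 0) := by
      refine tendsto_nhdsWithin_iff.2 ⟨?_, ?_⟩
      · have : Tendsto (fun x : ℝ => x / s) (𝓝 0) (𝓝 (0 / s)) :=
          (continuous_id.div_const s).tendsto 0
        rw [zero_div] at this
        exact tendsto_nhdsWithin_of_tendsto_nhds this
      · exact eventually_nhdsWithin_of_forall fun x hx => div_pos hx hs
    exact Real.tendsto_exp_atBot.comp (tendsto_neg_atTop_atBot.comp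
      ((tendsto_rpow_neg_nhdsGT_zero (neg_neg_of_pos hα0)).comp h1))
  have hder : ∀ y, 0 < y → HasDerivAt G
      (α / s * (y / s) ^ (-α - 1) * Real.exp (-(y / s) ^ (-α))) y := by
    intro y hy
    have h1 := ((hasDerivAt_id y).div_const s).rpow_const (p := -α)
      (Or.inl (div_pos hy hs).ne')
    convert! h1.neg.exp using 1
    simp only [id, Pi.neg_apply]
    ring
  have htail : ∀ x, 0 < x → frechetMeasure α s (Ioi x) = ENNReal.ofReal (1 - G x) := fun x hx =>
    withDensity_Ioi (hder x hx).continuousAt.continuousWithinAt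
      (fun y hy => by rw [if_pos (hx.trans hy)]; exact hder y (hx.trans hy))
      (fun y hy => by rw [if_pos (hx.trans hy)]; have : 0 < y := hx.trans hy; positivity) hlimT
  have htail0 : frechetMeasure α s (Ioi 0) = 1 := by
    have hU : ⋃ n : ℕ, Ioi (1 / ((n : ℝ) + 1)) = Ioi 0 := by
      ext x
      rw [mem_iUnion]
      constructor
      · rintro ⟨n, hn⟩
        exact lt_trans (by positivity : (0 : ℝ) < 1 / ((n : ℝ) + 1)) hn
      · intro hx
        obtain ⟨n, hn⟩ := exists_nat_one_div_lt (mem_Ioi.1 hx)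
        exact ⟨n, hn⟩
    rw [← hU]
    refine measure_iUnion_Ioi_eq_one (fun m n hmn => ?_) (fun n => htail _ (by positivity))
      (hlim0.comp (tendsto_nhdsWithin_iff.2 ⟨tendsto_one_div_add_atTop_nhds_zero_nat,
        Eventually.of_forall fun n => ?_⟩))
    · exact one_div_le_one_div_of_le (by positivity) (by gcongr)
    · rw [mem_Ioi]; positivity
  refine ⟨⟨?_⟩, hazardLE_withDensity (by positivity) fun x => ?_, ?_, ?_⟩
  · rw [← compl_union_self (Ioi (0 : ℝ)),
      measure_union disjoint_compl_left measurableSet_Ioi, htail0, compl_Ioi, frechetMeasure,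
      withDensity_apply _ measurableSet_Iic,
      setLIntegral_eq_zero measurableSet_Iic fun x hx => by
        rw [if_neg (not_lt.2 hx), ENNReal.ofReal_zero]; rfl]
    simp
  · change _ ≤ _ * frechetMeasure α s (Ioi x)
    split_ifs with hx
    · rw [htail x hx, ← ENNReal.ofReal_mul (by positivity)]
      refine ENNReal.ofReal_le_ofReal ?_
      simp only [hG]
      set u := x / s
      have hu : 0 < u := div_pos hx hs
      set v := u ^ (-α) with hv
      have hv0 : 0 < v := Real.rpow_pos_of_pos hu _
      have e : u ^ (-α - 1) = v * u⁻¹ := by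
        rw [Real.rpow_sub_one hu.ne', div_eq_mul_inv]
      have h3 : u⁻¹ ≤ 1 + v := by
        rcases le_total 1 u with h1 | h1
        · have : u⁻¹ ≤ 1 := inv_le_one_of_one_le₀ h1
          linarith
        · have : u⁻¹ ≤ v := by
            rw [hv, ← Real.rpow_neg_one]
            exact Real.rpow_le_rpow_of_exponent_ge hu h1 (by linarith)
          linarith
      have h4 : v * (1 + v) ≤ 2 * (Real.exp v - 1) := by
        have := Real.quadratic_le_exp_of_nonneg hv0.le
        nlinarith
      have h5 : Real.exp v * Real.exp (-v) = 1 := by rw [← Real.exp_add]; simp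
      have h6 : v * u⁻¹ * Real.exp (-v) ≤ 2 * (1 - Real.exp (-v)) := by
        have h7 : v * u⁻¹ ≤ 2 * (Real.exp v - 1) :=
          (mul_le_mul_of_nonneg_left h3 hv0.le).trans h4
        have := mul_le_mul_of_nonneg_right h7 (Real.exp_pos (-v)).le
        nlinarith
      rw [e]
      calc α / s * (v * u⁻¹) * Real.exp (-v) = α / s * (v * u⁻¹ * Real.exp (-v)) := by ring
        _ ≤ α / s * (2 * (1 - Real.exp (-v))) := by gcongr
        _ = _ := by ring
    · simp
  · refine lintegral_excess_rpow_le (hs.trans_le ha) hs hα fun t ht => ?_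
    have hat : 0 < a + t := by linarith
    rw [htail _ hat]
    refine ENNReal.ofReal_le_ofReal ?_
    have h1 := Real.add_one_le_exp (-((a + t) / s) ^ (-α))
    have h2 : ((a + t) / s) ^ (-α) = s ^ α * (a + t) ^ (-α) := by
      rw [Real.div_rpow hat.le hs.le, Real.rpow_neg hs.le]
      field_simp
    simp only [hG]
    linarith
  · refine (lintegral_ofReal_neg_eq_zero fun x hx => ?_).le.trans zero_le
    rw [if_neg (not_lt.2 hx.le)]; simp

end Tails

end Bandit

namespace Bandit

/-! ### Choice of the distribution parameters -/

section Tuning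

/-- The conclusion of the theorem for one family of perturbations. -/
lemma ftpl_guarantee {N T : ℕ} (hN : 0 < N) {D : Measure ℝ} {h a K K' R : ℝ}
    (hD : IsPerturbation D h a K K') (hh : 0 ≤ h) (hK : 0 ≤ K) (hK' : 0 ≤ K') (hR : 0 ≤ R)
    (hbound : 1 < N → 0 < T → a + N * K + K' + N * T * h / 2 ≤ R) :
    IsProbabilityMeasure D ∧
      (∀ L : Fin N → ℝ, Integrable (fun z : Fin N → ℝ => ⨅ i, (L i - z i))
        (Measure.pi fun _ : Fin N => D)) ∧
      IsPotential (ftplPotential N D) ∧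
      ∀ ℓ : Fin T → Fin N → ℝ, UnitLosses ℓ → expectedRegret (ftplPotential N D) ℓ ≤ R := by
  have := hD.isProb
  have : NeZero N := ⟨hN.ne'⟩
  refine ⟨hD.isProb, integrable_ciInf_sub hD.integrable, hD.isPotential hN, fun ℓ hℓ => ?_⟩
  by_cases h1 : N = 1 ∨ T = 0
  · rwa [expectedRegret_eq_zero (hD.isPotential hN) hN h1]
  · rw [not_or] at h1
    exact (hD.regret_le hN hh hK hK' ℓ hℓ).trans
      (hbound (by omega) (Nat.pos_of_ne_zero h1.2))

lemma half_lt_log {N : ℕ} (hN : 1 < N) : 1 / 2 < Real.log N := by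
  have := Real.log_le_log two_pos (show (2 : ℝ) ≤ N by exact_mod_cast hN)
  linarith [Real.log_two_gt_d9]

lemma sqrt_mul_log_pos {N T : ℕ} (hN : 1 < N) (hT : 0 < T) :
    0 < Real.sqrt ((N : ℝ) * T * Real.log N) := by
  have h1 := half_lt_log hN
  have h2 : (0 : ℝ) < N := by exact_mod_cast (by omega : 0 < N)
  have h3 : (0 : ℝ) < T := by exact_mod_cast hT
  exact Real.sqrt_pos.2 (mul_pos (mul_pos h2 h3) (by linarith))

/-- Tuning of perturbations with exponential tails. -/
lemma exists_scale_exponential_tail {laws : Set (Measure ℝ)}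
    (hlaws : ∀ b : ℝ, 0 < b → ∃ D ∈ laws, ∀ a : ℝ, 0 ≤ a →
      IsPerturbation D (1 / b) a (b * Real.exp (-a / b)) b)
    {N : ℕ} (T : ℕ) (hN : 0 < N) :
    ∃ D ∈ laws, IsProbabilityMeasure D ∧
      (∀ L : Fin N → ℝ, Integrable (fun z : Fin N → ℝ => ⨅ i, (L i - z i))
        (Measure.pi fun _ : Fin N => D)) ∧
      IsPotential (ftplPotential N D) ∧
      ∀ ℓ : Fin T → Fin N → ℝ, UnitLosses ℓ →
        expectedRegret (ftplPotential N D) ℓ ≤ 10 * Real.sqrt ((N : ℝ) * T * Real.log N) := by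
  have hlog0 : 0 ≤ Real.log (N : ℝ) := Real.log_natCast_nonneg N
  set R := Real.sqrt ((N : ℝ) * T * Real.log N) with hR
  have hR0 : 0 ≤ R := Real.sqrt_nonneg _
  -- This is b = √(NT/log N), which balances b log N against NT/b. In the degenerate cases any
  -- positive scale works since there is no regret.
  obtain ⟨b, hb, hbR⟩ : ∃ b : ℝ, 0 < b ∧ (1 < N → 0 < T → b * Real.log N = R) := by
    by_cases h : 1 < N ∧ 0 < T
    · have h1 := half_lt_log h.1
      have h2 : 0 < R := sqrt_mul_log_pos h.1 h.2
      exact ⟨R / Real.log N, div_pos h2 (by linarith), fun _ _ => div_mul_cancel₀ _ (by linarith)⟩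
    · exact ⟨1, one_pos, fun h1 h2 => absurd ⟨h1, h2⟩ h⟩
  obtain ⟨D, hD, hpert⟩ := hlaws b hb
  -- At level b log N the tail is 1/N, so the total excess over all arms is only b, at most 2R
  -- because log N > 1/2.
  refine ⟨D, hD, ftpl_guarantee hN (hpert (b * Real.log N) (by positivity)) (by positivity)
    (by positivity) hb.le (by positivity) fun hN1 hT => ?_⟩
  have hlog := half_lt_log hN1
  have hN0 : (0 : ℝ) < N := by exact_mod_cast hN
  have e1 : (N : ℝ) * (b * Real.exp (-(b * Real.log N) / b)) = b := by
    rw [← mul_neg, mul_div_cancel_left₀ _ hb.ne', Real.exp_neg, Real.exp_log hN0]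
    field_simp
  have e2 : (N : ℝ) * T * (1 / b) / 2 = R / 2 := by
    have h1 : R * R = N * T * Real.log N := Real.mul_self_sqrt (by positivity)
    have h2 : R * b = N * T := by
      have : Real.log N * (R * b) = Real.log N * (N * T) := by
        rw [← hbR hN1 hT] at h1 ⊢
        linarith
      exact mul_left_cancel₀ (by linarith) this
    rw [← h2]
    field_simp
  rw [e1, e2, hbR hN1 hT]
  have := hbR hN1 hT
  nlinarith

/-- Tuning of perturbations with polynomial tails. -/
lemma exists_shape_polynomial_tail {laws : Set (Measure ℝ)}
    (hlaws : ∀ s α : ℝ, 0 < s → 1 < α → ∃ D ∈ laws, ∀ a : ℝ, s ≤ a →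
      IsPerturbation D (2 * α / s) a (s ^ α * a ^ (1 - α) / (α - 1)) 0)
    {N : ℕ} (T : ℕ) (hN : 0 < N) :
    ∃ D ∈ laws, IsProbabilityMeasure D ∧
      (∀ L : Fin N → ℝ, Integrable (fun z : Fin N → ℝ => ⨅ i, (L i - z i))
        (Measure.pi fun _ : Fin N => D)) ∧
      IsPotential (ftplPotential N D) ∧
      ∀ ℓ : Fin T → Fin N → ℝ, UnitLosses ℓ →
        expectedRegret (ftplPotential N D) ℓ ≤ 11 * Real.sqrt ((N : ℝ) * T * Real.log N) := by
  have hN0 : (0 : ℝ) < N := by exact_mod_cast hN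
  have hlog0 : 0 ≤ Real.log (N : ℝ) := Real.log_natCast_nonneg N
  set R := Real.sqrt ((N : ℝ) * T * Real.log N) with hR
  have hR0 : 0 ≤ R := Real.sqrt_nonneg _
  obtain ⟨s, hs, hsR⟩ : ∃ s : ℝ, 0 < s ∧ (1 < N → 0 < T → s = R) := by
    by_cases h : 1 < N ∧ 0 < T
    · exact ⟨R, sqrt_mul_log_pos h.1 h.2, fun _ _ => rfl⟩
    · exact ⟨1, one_pos, fun h1 h2 => absurd ⟨h1, h2⟩ h⟩
  -- A shape of order log N keeps w = N^(1/α) below e while the hazard rate grows only like log N;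
  -- the summand 2 gives α - 1 ≥ 1. At the level sw the Pareto tail is exactly 1/N.
  set α := 2 + Real.log N with hα
  have hα1 : 1 < α := by linarith
  set w := Real.exp (Real.log N / α) with hw
  have hw1 : 1 ≤ w := Real.one_le_exp (by positivity)
  have hw3 : w ≤ 3 := by
    have h1 : Real.log N / α ≤ 1 := by rw [div_le_one (by linarith)]; linarith
    have := Real.exp_le_exp.2 h1
    linarith [Real.exp_one_lt_d9]
  have hwα : w ^ α = N := by
    rw [hw, ← Real.exp_mul, div_mul_cancel₀ _ (by linarith), Real.exp_log hN0]
  obtain ⟨D, hD, hpert⟩ := hlaws s α hs hα1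
  have hα2 : 0 < α - 1 := by linarith
  refine ⟨D, hD, ftpl_guarantee hN (hpert (s * w) (by nlinarith)) (by positivity)
    (by positivity) le_rfl (by positivity) fun hN1 hT => ?_⟩
  have hlog := half_lt_log hN1
  have e1 : (N : ℝ) * (s ^ α * (s * w) ^ (1 - α) / (α - 1)) = s * w / (α - 1) := by
    have hsw : 0 < s * w := by positivity
    rw [Real.rpow_sub hsw, Real.rpow_one, Real.mul_rpow hs.le (by positivity), hwα]
    have := (Real.rpow_pos_of_pos hs α).ne'
    field_simp
  have e2 : s * w / (α - 1) ≤ s * w := div_le_self (by positivity) (by linarith)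
  -- From log N > 1/2 follows α ≤ 5 log N. With w ≤ 3 the level, the excess and this term add up to
  -- at most 3R + 3R + 5R.
  have e3 : (N : ℝ) * T * (2 * α / s) / 2 ≤ 5 * R := by
    have h1 : R * R = N * T * Real.log N := Real.mul_self_sqrt (by positivity)
    have h2 : (N : ℝ) * T * (2 * α / s) / 2 = N * T * α / s := by ring
    rw [h2, div_le_iff₀ hs, hsR hN1 hT, mul_assoc (5 : ℝ), h1]
    have h3 : 0 ≤ (N : ℝ) * T := by positivity
    nlinarith
  rw [e1]
  have := hsR hN1 hT
  nlinarith

/-- Gamma and Weibull are used only at shape 1, where both are exponential; Gumbel has the same type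
of tail. Fréchet and Pareto take the polynomial tuning. -/
lemma Family.exists_law_regret_le (fam : Family) {N : ℕ} (T : ℕ) (hN : 0 < N) :
    ∃ D ∈ fam.laws, IsProbabilityMeasure D ∧
      (∀ L : Fin N → ℝ, Integrable (fun z : Fin N → ℝ => ⨅ i, (L i - z i))
        (Measure.pi fun _ : Fin N => D)) ∧
      IsPotential (ftplPotential N D) ∧
      ∀ ℓ : Fin T → Fin N → ℝ, UnitLosses ℓ →
        expectedRegret (ftplPotential N D) ℓ ≤ 11 * Real.sqrt ((N : ℝ) * T * Real.log N) := by
  have hexp : ∀ {laws : Set (Measure ℝ)}, (∀ b : ℝ, 0 < b → ∃ D ∈ laws, ∀ a : ℝ, 0 ≤ a →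
      IsPerturbation D (1 / b) a (b * Real.exp (-a / b)) b) → ∃ D ∈ laws, IsProbabilityMeasure D ∧
      (∀ L : Fin N → ℝ, Integrable (fun z : Fin N → ℝ => ⨅ i, (L i - z i))
        (Measure.pi fun _ : Fin N => D)) ∧
      IsPotential (ftplPotential N D) ∧
      ∀ ℓ : Fin T → Fin N → ℝ, UnitLosses ℓ →
        expectedRegret (ftplPotential N D) ℓ ≤ 11 * Real.sqrt ((N : ℝ) * T * Real.log N) := by
    intro laws hlaws
    obtain ⟨D, hD, h1, h2, h3, h4⟩ := exists_scale_exponential_tail hlaws T hN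
    refine ⟨D, hD, h1, h2, h3, fun ℓ hℓ => (h4 ℓ hℓ).trans ?_⟩
    gcongr
    norm_num
  cases fam with
  | gamma =>
    refine hexp (laws := Family.laws .gamma) fun b hb =>
      ⟨gammaMeasure 1 (1 / b), ⟨1, 1 / b, one_pos, by positivity, rfl⟩, fun a ha => ?_⟩
    rw [gammaMeasure_one]
    exact isPerturbation_exponential hb ha
  | weibull =>
    refine hexp (laws := Family.laws .weibull) fun b hb =>
      ⟨weibullMeasure b 1, ⟨b, 1, hb, one_pos, rfl⟩, fun a ha => ?_⟩
    rw [weibullMeasure_one]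
    exact isPerturbation_exponential hb ha
  | gumbel =>
    exact hexp fun b hb => ⟨gumbelMeasure 0 b, ⟨0, b, hb, rfl⟩,
      fun a _ => isPerturbation_gumbel hb a⟩
  | frechet =>
    exact exists_shape_polynomial_tail (laws := Family.laws .frechet) (fun s α hs hα => ⟨frechetMeasure α s,
      ⟨α, s, hα, hs, rfl⟩, fun a ha => isPerturbation_frechet hs hα ha⟩) T hN
  | pareto =>
    exact exists_shape_polynomial_tail (laws := Family.laws .pareto) (fun s α hs hα => ⟨paretoMeasure s α,
      ⟨s, α, hs, by linarith, rfl⟩, fun a ha => isPerturbation_pareto hs hα ha⟩) T hN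

end Tuning

end Bandit

theorem theorem3 :
    -- FTPL: one constant for all families, all numbers of arms and all horizons
    (∃ C : ℝ, ∀ (fam : Bandit.Family) (N T : ℕ), 0 < N →
      ∃ D ∈ fam.laws,
        IsProbabilityMeasure D ∧
        (∀ L : Fin N → ℝ, Integrable (fun z : Fin N → ℝ => ⨅ i, (L i - z i))
          (Measure.pi fun _ : Fin N => D)) ∧
        Bandit.IsPotential (Bandit.ftplPotential N D) ∧
        ∀ ℓ : Fin T → Fin N → ℝ, Bandit.UnitLosses ℓ →
          Bandit.expectedRegret (Bandit.ftplPotential N D) ℓ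
            ≤ C * Real.sqrt ((N : ℝ) * (T : ℝ) * Real.log (N : ℝ))) ∧
    -- FTRL with the Tsallis negative entropy: the constant may depend on `α` only
    (∀ α : ℝ, 0 < α → α < 1 →
      ∃ C : ℝ, ∀ N T : ℕ, 0 < N →
        ∃ η : ℝ, 0 < η ∧
          Bandit.MinAttained (stdSimplex ℝ (Fin N)) (Bandit.tsallisNegEntropy α η) ∧
          Bandit.IsPotential (Bandit.tsallisPotential N α η) ∧
          ∀ ℓ : Fin T → Fin N → ℝ, Bandit.UnitLosses ℓ →
            Bandit.expectedRegret (Bandit.tsallisPotential N α η) ℓ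
              ≤ C * Real.sqrt ((N : ℝ) * (T : ℝ))) ∧
    -- FTRL with the log-barrier: `η` is tuned with `N`, `T` and the value `B` of the best loss
    (∃ C : ℝ, ∀ (N T : ℕ) (B : ℝ), 0 < N →
      ∃ η : ℝ, 0 < η ∧
        Bandit.MinAttained (Bandit.openSimplex N) (Bandit.logBarrier η) ∧
        Bandit.IsPotential (Bandit.logBarrierPotential N η) ∧
        ∀ ℓ : Fin T → Fin N → ℝ, Bandit.UnitLosses ℓ → Bandit.bestLoss ℓ = B →
          Bandit.expectedRegret (Bandit.logBarrierPotential N η) ℓ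
            ≤ C * (Real.sqrt ((N : ℝ) * B * Real.log ((N : ℝ) * (T : ℝ)))
                + (N : ℝ) * Real.log ((N : ℝ) * (T : ℝ)))) := by
  refine ⟨⟨11, fun fam N T hN => fam.exists_law_regret_le T hN⟩,
    fun α h0 h1 => Bandit.exists_tsallis_regret_le h0 h1, ⟨4, fun N T B hN => ?_⟩⟩
  -- The maximum with 1 keeps η positive for every B, including values that no loss sequence attains
  -- and degenerate quotients.
  have hη : 0 < max 1 (Real.sqrt (N * B * Real.log (N * T)) / (N * Real.log (N * T))) :=
    lt_max_of_lt_left one_pos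
  have hreg := Bandit.isSeparableRegularizer_logBarrier hN hη
  refine ⟨_, hη, hreg.minAttained, hreg.isPotential, fun ℓ hℓ hB => ?_⟩
  subst hB
  exact Bandit.logBarrier_regret_le hN ℓ hℓ rfl
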